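/- **Setting.** Let $\Sigma$ be a compact connected Riemann surface, $U_-\subset\Sigma$ a holomorphic coordinate disk with centre $p$ (i.e. $U_-$ is the domain of a holomorphic chart onto the open unit disk, sending $p$ to $0$), $U_+=\Sigma\setminus\{p\}$ and $U^*=U_-\cap U_+$ the punctured disk. For $n\ge 0$ let $LGL(n,\mathbb C)$ be the group of holomorphic maps $U^*\to GL(n,\mathbb C)$. Let $G=GL(n,\mathbb C)$ or $SL(n,\mathbb C)$ with Lie algebra $\mathfrak g$, let $L\mathfrak g$ be the Lie algebra of holomorphic maps $U^*\to\mathfrak g$, fix $T\in LGL(n,\mathbb C)$ (a transition matrix) and an integer $k\ge 0$, and put * $L\mathfrak g_-$: restrictions of holomorphic maps $U_-\to\mathfrak g$ vanishing to order at least $k$ at $p$ (no condition if $k=0$); $LG_-$: restrictions of holomorphic maps $U_-\to G$ congruent to $1$ to order $k$ at $p$; * $L\mathfrak g_+=\{TaT^{-1}\,:\,a:U_+\to\mathfrak g \text{ holomorphic}\}$; $LG_+=\{TaT^{-1}\,:\,a:U_+\to G\text{ holomorphic}\}$. Assume that $L\mathfrak g=L\mathfrak g_+\oplus L\mathfrak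 g_-$, with projections $\xi\mapsto\xi_\pm$. (The basic case is $k=0$; $k=1$ is the normalisation used for the rational splitting.) The dressing action on $LGL(n,\mathbb C)$ is the partially defined action of $LG_-\times LG_+$ which sends $h$ to $h'=a^{-1}hh_+=b^{-1}hh_-$ whenever $h_\pm\in LG_\pm$ and $hh_+h_-^{-1}h^{-1}=ab^{-1}$ with $a\in LG_+$, $b\in LG_-$. Its orbits are the symplectic leaves (dressing orbits). The tangent space at $h$ of the leaf through $h$, translated to the identity by right multiplication by $h^{-1}$, is the subspace of $L\mathfrak g$ spanned by all $(\mathrm{Ad}_h\xi_+)_-$ with $\xi_+\in L\mathfrak g_+$ and all $(\mathrm{Ad}_h\xi_-)_+$ with $\xi_-\in L\mathfrak g_-$; the leaf through $h$ is called finite-dimensional if this space is finite-dimensional. **Theorem.** (a) The leaf through $h\in LGL(n,\mathbb C)$ is finite-dimensional if and only if $h$ is of the form $h=f\,g$ on $U^*$ (as meromorphic functions), where $f$ is a scalar meromorphic function on $U^*$, and $g$ is a matrix-valued function which has at most a pole of finite order at $p$ and for which $T^{-1}gT$ extends to a meromorphic matrix-valued function on $\Sigma\setminus\{p\}$ with finitely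 many poles. Moreover, let $h=fg$ be of this form. Then every $h'$ in the dressing orbit of $h$ is again of this form with the same scalar $f$, $h'=fg'$, where: (b) the poles have the same location and order: $g'$ and $g$ have the same order of pole at $p$, and the meromorphic functions $T^{-1}g'T$ and $T^{-1}gT$ on $\Sigma\setminus\{p\}$ have the same order of pole (possibly $0$) at every point (the order of pole of a matrix being the largest order of pole of its entries); (c) the determinant vanishes at the same points: $\det g'$ and $\det g$ have the same order at $p$, and $\det(T^{-1}g'T)$ and $\det(T^{-1}gT)$ have the same order at every point of $\Sigma\setminus\{p\}$; in particular they have the same zeros. -/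

import Mathlib

open Matrix Topology TopologicalSpace
open scoped Manifold ContDiff

noncomputable section

namespace Sklyanin

/-- The ring of holomorphic functions on an open subset `U` of a Riemann surface `X`. -/
abbrev Hol {X : Type*} [TopologicalSpace X] [ChartedSpace ℂ X] (U : Opens X) : Type _ :=
  C^ω⟮𝓘(ℂ), U; 𝓘(ℂ), ℂ⟯

/-- Restriction of holomorphic functions to a smaller open set. -/
def res {X : Type*} [TopologicalSpace X] [ChartedSpace ℂ X] {U V : Opens X} (h : U ≤ V) :
    Hol V →ₐ[ℂ] Hol U :=
  { ContMDiffMap.restrictRingHom 𝓘(ℂ) 𝓘(ℂ) ℂ h with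
    commutes' := fun _ => rfl }

/-- The ideal of holomorphic functions on `U` that vanish at the point `p`. -/
def vanishingIdeal {X : Type*} [TopologicalSpace X] [ChartedSpace ℂ X] (U : Opens X) (p : X) :
    Ideal (Hol U) where
  carrier := {F | ∀ x : U, x.1 = p → F x = 0}
  add_mem' := fun {a b} ha hb x hx => by
    rw [ContMDiffMap.coe_add, Pi.add_apply, ha x hx, hb x hx, add_zero]
  zero_mem' := fun _ _ => rfl
  smul_mem' := fun c a ha x hx => by
    rw [smul_eq_mul, ContMDiffMap.coe_mul, Pi.mul_apply, ha x hx, mul_zero]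

/-- The structure group `G` of the loops that are split: `GL(n)` or `SL(n)`. -/
inductive StructureGroup
  | gl
  | sl

/-- The `R`-points of `G`, as a subgroup of `GL(n, R)`. -/
def StructureGroup.points (G : StructureGroup) (n : ℕ) (R : Type*) [CommRing R] :
    Subgroup (GL (Fin n) R) :=
  match G with
  | .gl => ⊤
  | .sl => (Matrix.GeneralLinearGroup.det : GL (Fin n) R →* Rˣ).ker

/-- The Lie algebra of `G` over `R`: all matrices, or all matrices of trace zero. -/
def StructureGroup.lie (G : StructureGroup) (n : ℕ) (R : Type*) [CommRing R] [Algebra ℂ R] :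
    Submodule ℂ (Matrix (Fin n) (Fin n) R) :=
  match G with
  | .gl => ⊤
  | .sl => LinearMap.ker (Matrix.traceLinearMap (Fin n) ℂ R)

/-- A holomorphic coordinate disk in a Riemann surface: a holomorphic chart whose image is the
open unit disk. (If `z` is a coordinate with `z = ∞` at the centre, `coord = 1 / z`.) -/
structure CoordDisk (X : Type*) [TopologicalSpace X] [ChartedSpace ℂ X] where
  coord : OpenPartialHomeomorph X ℂ
  coord_mem : coord ∈ IsManifold.maximalAtlas 𝓘(ℂ) ω X
  target_eq : coord.target = Metric.ball (0 : ℂ) 1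

section setup

variable {X : Type*} [TopologicalSpace X] [ChartedSpace ℂ X]

/-- The centre `p` of the disk. -/
def CoordDisk.center (D : CoordDisk X) : X := D.coord.symm 0

/-- The disk `U₋`. -/
def CoordDisk.Um (D : CoordDisk X) : Opens X := ⟨D.coord.source, D.coord.open_source⟩

variable [T2Space X]

/-- The complement `U₊` of the centre in the surface. -/
def CoordDisk.Up (D : CoordDisk X) : Opens X := ⟨{D.center}ᶜ, isOpen_compl_singleton⟩

/-- The punctured disk `U₋ ∩ U₊`, on which the loops live. -/
def CoordDisk.Upunct (D : CoordDisk X) : Opens X := D.Um ⊓ D.Up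

/-- The loop group `LGL(n, ℂ)`: holomorphic maps from the punctured disk to `GL(n, ℂ)`. -/
abbrev LGL (D : CoordDisk X) (n : ℕ) : Type _ := GL (Fin n) (Hol D.Upunct)

variable (D : CoordDisk X) {n : ℕ}

/-- The loop algebra `L𝔤`: holomorphic maps from the punctured disk to `𝔤`. -/
abbrev loopAlg (n : ℕ) (G : StructureGroup) :
    Submodule ℂ (Matrix (Fin n) (Fin n) (Hol D.Upunct)) :=
  G.lie n (Hol D.Upunct)

/-- Conjugation `ξ ↦ g ξ g⁻¹` by a loop, on all matrix-valued functions. -/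
def conjLin (g : LGL D n) :
    Matrix (Fin n) (Fin n) (Hol D.Upunct) →ₗ[ℂ] Matrix (Fin n) (Fin n) (Hol D.Upunct) :=
  LinearMap.mulRight ℂ (↑g⁻¹ : Matrix (Fin n) (Fin n) (Hol D.Upunct)) ∘ₗ
    LinearMap.mulLeft ℂ (↑g : Matrix (Fin n) (Fin n) (Hol D.Upunct))

theorem conjLin_apply (g : LGL D n) (M : Matrix (Fin n) (Fin n) (Hol D.Upunct)) :
    conjLin D g M =
      (g : Matrix (Fin n) (Fin n) (Hol D.Upunct)) * M *
        (↑g⁻¹ : Matrix (Fin n) (Fin n) (Hol D.Upunct)) := rfl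

theorem conjLin_mem (G : StructureGroup) (g : LGL D n) :
    ∀ M ∈ loopAlg D n G, conjLin D g M ∈ loopAlg D n G := by
  intro M hM
  cases G with
  | gl => trivial
  | sl =>
    have h1 : Matrix.trace M = 0 := hM
    change Matrix.trace (conjLin D g M) = 0
    rw [conjLin_apply]
    rw [Matrix.trace_mul_comm, ← mul_assoc, ← Units.val_mul, inv_mul_cancel, Units.val_one,
      one_mul, h1]

/-- The adjoint action `Ad_g` of `LGL(n, ℂ)` on `L𝔤`. -/
def Ad (G : StructureGroup) (g : LGL D n) : loopAlg D n G →ₗ[ℂ] loopAlg D n G :=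
  (conjLin D g).restrict (conjLin_mem D G g)

/-- `L𝔤₋`: the `𝔤`-valued functions that extend holomorphically to `U₋`, with a zero of order at
least `k` at the centre (no condition if `k = 0`). -/
def loopMinus (n : ℕ) (G : StructureGroup) (k : ℕ) : Submodule ℂ (loopAlg D n G) :=
  ((G.lie n (Hol D.Um) ⊓
      (Ideal.matrix (Fin n) (vanishingIdeal D.Um D.center ^ k)).restrictScalars ℂ).map
    (res (inf_le_left : D.Upunct ≤ D.Um)).mapMatrix.toLinearMap).comap (loopAlg D n G).subtype

/-- `L𝔤₊`: the functions `T a T⁻¹` with `a` a holomorphic `𝔤`-valued function on `U₊`. -/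
def loopPlus (G : StructureGroup) (T : LGL D n) : Submodule ℂ (loopAlg D n G) :=
  ((G.lie n (Hol D.Up)).map
    (conjLin D T ∘ₗ (res (inf_le_right : D.Upunct ≤ D.Up)).mapMatrix.toLinearMap)).comap
      (loopAlg D n G).subtype

/-- `LG₋`: the holomorphic maps from `U₋` to `G` that are `1` to order `k` at the centre
(no condition if `k = 0`). -/
def groupMinus (n : ℕ) (G : StructureGroup) (k : ℕ) : Subgroup (LGL D n) :=
  (G.points n (Hol D.Um) ⊓
      (Matrix.GeneralLinearGroup.map (n := Fin n)
        (Ideal.Quotient.mk (vanishingIdeal D.Um D.center ^ k))).ker).map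
    (Matrix.GeneralLinearGroup.map (n := Fin n)
      (res (inf_le_left : D.Upunct ≤ D.Um)).toRingHom)

/-- `LG₊`: the loops `T a T⁻¹` with `a` a holomorphic map from `U₊` to `G`. -/
def groupPlus (G : StructureGroup) (T : LGL D n) : Subgroup (LGL D n) :=
  ((G.points n (Hol D.Up)).map
    (Matrix.GeneralLinearGroup.map (n := Fin n)
      (res (inf_le_right : D.Upunct ≤ D.Up)).toRingHom)).map
    (MulAut.conj T).toMonoidHom

/-- `g'` is the result of the (partially defined) dressing action of `(h₊, h₋)` on `g`:
if `g h₊ h₋⁻¹ g⁻¹ = a b⁻¹` with `a ∈ LG₊`, `b ∈ LG₋`, then `g' = a⁻¹ g h₊` (`= b⁻¹ g h₋`). -/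
def IsDressing (G : StructureGroup) (k : ℕ) (T hp hm g g' : LGL D n) : Prop :=
  ∃ a ∈ groupPlus D G T, ∃ b ∈ groupMinus D n G k,
    g * hp * hm⁻¹ * g⁻¹ = a * b⁻¹ ∧ g' = a⁻¹ * g * hp

/-- The orbit of `g` under the dressing action of `LG₋ × LG₊` on `LGL(n, ℂ)`. -/
def dressingOrbit (G : StructureGroup) (k : ℕ) (T g : LGL D n) : Set (LGL D n) :=
  {g' | ∃ hp ∈ groupPlus D G T, ∃ hm ∈ groupMinus D n G k, IsDressing D G k T hp hm g g'}

/-- The dressing orbits partition the loop group. -/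
theorem dressingOrbit_equivalence (G : StructureGroup) (k : ℕ) (T : LGL D n) :
    Equivalence fun g g' : LGL D n => g' ∈ dressingOrbit D G k T g := by
  have key : ∀ g g' : LGL D n, g' ∈ dressingOrbit D G k T g ↔
      (∃ a ∈ groupPlus D G T, ∃ c ∈ groupPlus D G T, g' = a * g * c) ∧
      (∃ b ∈ groupMinus D n G k, ∃ c ∈ groupMinus D n G k, g' = b * g * c) := by
    intro g g'
    constructor
    · rintro ⟨hp, hhp, hm, hhm, a, ha, b, hb, h1, rfl⟩
      refine ⟨⟨a⁻¹, inv_mem ha, hp, hhp, rfl⟩, ⟨b⁻¹, inv_mem hb, hm, hhm, ?_⟩⟩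
      have h2 : g * hp = a * b⁻¹ * g * hm := by rw [← h1]; group
      rw [mul_assoc, h2]; group
    · rintro ⟨⟨a, ha, c, hc, rfl⟩, ⟨b, hb, d, hd, h⟩⟩
      refine ⟨c, hc, d, hd, a⁻¹, inv_mem ha, b⁻¹, inv_mem hb, ?_, by rw [inv_inv]⟩
      have h2 : g * c = a⁻¹ * (b * g * d) := by rw [← h]; group
      rw [h2]; group
  refine ⟨fun g => ?_, fun {x y} h => ?_, fun {x y z} h h' => ?_⟩
  · exact (key g g).2 ⟨⟨1, one_mem _, 1, one_mem _, by simp⟩, ⟨1, one_mem _, 1, one_mem _, by simp⟩⟩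
  · obtain ⟨⟨a, ha, c, hc, e⟩, ⟨b, hb, d, hd, e'⟩⟩ := (key x y).1 h
    refine (key y x).2 ⟨⟨a⁻¹, inv_mem ha, c⁻¹, inv_mem hc, ?_⟩,
      ⟨b⁻¹, inv_mem hb, d⁻¹, inv_mem hd, ?_⟩⟩
    · rw [e]; group
    · rw [e']; group
  · obtain ⟨⟨a, ha, c, hc, e⟩, ⟨b, hb, d, hd, e'⟩⟩ := (key x y).1 h
    obtain ⟨⟨a1, ha1, c1, hc1, e1⟩, ⟨b1, hb1, d1, hd1, e1'⟩⟩ := (key y z).1 h'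
    refine (key x z).2 ⟨⟨a1 * a, mul_mem ha1 ha, c * c1, mul_mem hc hc1, ?_⟩,
      ⟨b1 * b, mul_mem hb1 hb, d * d1, mul_mem hd hd1, ?_⟩⟩
    · rw [e1, e]; group
    · rw [e1', e']; group

/-- The projection `P₊` of `L𝔤 = L𝔤₊ ⊕ L𝔤₋` onto `L𝔤₊`. -/
def projPlus {G : StructureGroup} {k : ℕ} {T : LGL D n}
    (hsplit : IsCompl (loopPlus D G T) (loopMinus D n G k)) :
    loopAlg D n G →ₗ[ℂ] loopAlg D n G :=
  Submodule.projection _ _ hsplit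

/-- The projection `P₋` of `L𝔤 = L𝔤₊ ⊕ L𝔤₋` onto `L𝔤₋`. -/
def projMinus {G : StructureGroup} {k : ℕ} {T : LGL D n}
    (hsplit : IsCompl (loopPlus D G T) (loopMinus D n G k)) :
    loopAlg D n G →ₗ[ℂ] loopAlg D n G :=
  Submodule.projection _ _ hsplit.symm

/-- The tangent space at `g` of the dressing orbit (translated to the identity by right
multiplication by `g⁻¹`): it is spanned by the values `(Ad_g ξ₊)₋` and `(Ad_g ξ₋)₊` of the vector
fields that generate the dressing action. -/
def dressingTangent {G : StructureGroup} {k : ℕ} {T : LGL D n}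
    (hsplit : IsCompl (loopPlus D G T) (loopMinus D n G k)) (g : LGL D n) :
    Submodule ℂ (loopAlg D n G) :=
  (loopPlus D G T).map (projMinus D hsplit ∘ₗ Ad D G g) ⊔
    (loopMinus D n G k).map (projPlus D hsplit ∘ₗ Ad D G g)

/-- The tangent space of the dressing orbit is the space of values at `g` of the Hamiltonian vector
fields of the bracket `{ψ, φ} = ⟨(Dψ)₊ - Ad_g (D'ψ)₊, Dφ⟩`, where `D'ψ = ζ` and
`Dψ = Ad_g ζ`. -/
theorem dressingTangent_eq_range {G : StructureGroup} {k : ℕ} {T : LGL D n}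
    (hsplit : IsCompl (loopPlus D G T) (loopMinus D n G k)) (g : LGL D n) :
    dressingTangent D hsplit g =
      LinearMap.range (projPlus D hsplit ∘ₗ Ad D G g - Ad D G g ∘ₗ projPlus D hsplit) := by
  have hsum : ∀ ζ, projPlus D hsplit ζ + projMinus D hsplit ζ = ζ := fun ζ =>
    Submodule.projection_add_projection_eq_self hsplit ζ
  have hp : ∀ ζ ∈ loopPlus D G T, projPlus D hsplit ζ = ζ := fun ζ hζ =>
    Submodule.projection_apply_of_mem_left hsplit hζ
  have hm : ∀ ζ ∈ loopMinus D n G k, projPlus D hsplit ζ = 0 := fun ζ hζ =>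
    Submodule.projection_apply_of_mem_right hsplit hζ
  have hpm : ∀ ζ, projPlus D hsplit ζ ∈ loopPlus D G T := fun ζ =>
    Submodule.projection_apply_mem hsplit ζ
  have hmm : ∀ ζ, projMinus D hsplit ζ ∈ loopMinus D n G k := fun ζ =>
    Submodule.projection_apply_mem hsplit.symm ζ
  apply le_antisymm
  · refine sup_le ?_ ?_
    · rintro _ ⟨ξ, hξ, rfl⟩
      refine ⟨-ξ, ?_⟩
      have := hsum (Ad D G g ξ)
      simp only [LinearMap.sub_apply, LinearMap.comp_apply, map_neg, hp ξ hξ]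
      rw [neg_sub, sub_eq_iff_eq_add']
      exact this.symm
    · rintro _ ⟨ξ, hξ, rfl⟩
      refine ⟨ξ, ?_⟩
      simp [hm ξ hξ]
  · rintro _ ⟨ζ, rfl⟩
    have e : (projPlus D hsplit ∘ₗ Ad D G g - Ad D G g ∘ₗ projPlus D hsplit) ζ =
        (projMinus D hsplit ∘ₗ Ad D G g) (-(projPlus D hsplit ζ)) +
        (projPlus D hsplit ∘ₗ Ad D G g) (projMinus D hsplit ζ) := by
      have h1 := hsum (Ad D G g (projPlus D hsplit ζ))
      have h2 : projPlus D hsplit (Ad D G g ζ) =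
          projPlus D hsplit (Ad D G g (projPlus D hsplit ζ)) +
          projPlus D hsplit (Ad D G g (projMinus D hsplit ζ)) := by
        rw [← map_add, ← map_add, hsum]
      simp only [LinearMap.sub_apply, LinearMap.comp_apply, map_neg, h2]
      nth_rewrite 2 [← h1]
      abel
    rw [e]
    exact Submodule.add_mem_sup (Submodule.mem_map_of_mem (neg_mem (hpm ζ)))
      (Submodule.mem_map_of_mem (hmm ζ))

/-- The symplectic leaf (dressing orbit) through `g` is finite-dimensional: its tangent space at
`g` is. -/
def HasFiniteDimLeaf {G : StructureGroup} {k : ℕ} {T : LGL D n}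
    (hsplit : IsCompl (loopPlus D G T) (loopMinus D n G k)) (g : LGL D n) : Prop :=
  FiniteDimensional ℂ (dressingTangent D hsplit g)

/-- The value of a matrix of holomorphic functions at a point. -/
def evalMat {U : Opens X} (M : Matrix (Fin n) (Fin n) (Hol U)) (x : U) :
    Matrix (Fin n) (Fin n) ℂ :=
  M.map fun F => F x

end setup

section meromorphic

variable {X : Type*} [TopologicalSpace X] [ChartedSpace ℂ X]

/-- `F` is meromorphic at the point `x` (read in the chart at `x`). Values of `F` at `x` and far
from `x` play no role. -/
def MeroAt (F : X → ℂ) (x : X) : Prop :=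
  MeromorphicAt (F ∘ (chartAt ℂ x).symm) (chartAt ℂ x x)

/-- The order of `F` at `x`: positive at zeros, negative at poles, `⊤` if `F` vanishes near `x`. -/
def ordAt (F : X → ℂ) (x : X) : WithTop ℤ :=
  meromorphicOrderAt (F ∘ (chartAt ℂ x).symm) (chartAt ℂ x x)

/-- A matrix-valued function is meromorphic at `x` if its entries are. -/
def MatMeroAt {n : ℕ} (M : X → Matrix (Fin n) (Fin n) ℂ) (x : X) : Prop :=
  ∀ i j, MeroAt (fun y => M y i j) x

/-- The order of the pole of a matrix-valued function at `x`: the largest order of a pole of an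
entry, and `0` if no entry has a pole. -/
def poleOrder {n : ℕ} (M : X → Matrix (Fin n) (Fin n) ℂ) (x : X) : ℕ :=
  Finset.univ.sup fun i => Finset.univ.sup fun j => (-(ordAt (fun y => M y i j) x).untop₀).toNat

/-- The order at `x` of the determinant of a matrix-valued function. -/
def detOrd {n : ℕ} (M : X → Matrix (Fin n) (Fin n) ℂ) (x : X) : WithTop ℤ :=
  ordAt (fun y => (M y).det) x

/-- The loop `h` is `f g`, as a meromorphic function on the punctured disk, with `f` scalar,
`g` with a pole of finite order at the centre, and `T⁻¹ g T` extending to a meromorphic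
function `m` on `U₊` with finitely many poles. -/
structure IsScalarTimesMeromorphic [T2Space X] (D : CoordDisk X) {n : ℕ} (T h : LGL D n)
    (f : X → ℂ) (g m : X → Matrix (Fin n) (Fin n) ℂ) : Prop where
  scalar_mero : ∀ x ∈ D.Upunct, MeroAt f x
  eq_mul : ∀ x ∈ D.Upunct, ∀ᶠ y in 𝓝[≠] x, ∀ hy : y ∈ D.Upunct,
    evalMat (h : Matrix (Fin n) (Fin n) (Hol D.Upunct)) ⟨y, hy⟩ = f y • g y
  mero_center : MatMeroAt g D.center
  conj_eq : ∀ y : D.Upunct, m y =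
    evalMat (↑T⁻¹ : Matrix (Fin n) (Fin n) (Hol D.Upunct)) y * g y *
      evalMat (↑T : Matrix (Fin n) (Fin n) (Hol D.Upunct)) y
  mero : ∀ x ∈ D.Up, MatMeroAt m x
  finite_poles : {x : X | x ∈ D.Up ∧ 0 < poleOrder m x}.Finite

end meromorphic

end Sklyanin

end

noncomputable section

namespace Sklyanin

open Filter

/-! ### Holomorphy, meromorphy and orders on a Riemann surface, read in charts. -/

section toolkit

/-! Sufficiency in (a). If `h = f g`, the scalar cancels in `Ad_h`, which is then conjugation by
`g`, or by `m = T⁻¹ g T` in the frame of `U₊`. If `a` vanishes on `U₊` to the combined pole orders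
of `m` and `m⁻¹`, then `m a m⁻¹` is holomorphic, so `Ad_h` keeps `T a T⁻¹` in `L𝔤₊` and its minus
part is zero. By compactness only finitely many points are involved, so this is a condition of
finite codimension; the same works at the centre with a high power of the coordinate `z`
(`finiteDimensional_plus`, `finiteDimensional_minus`).

Necessity for `n ≥ 2`. The functions on `U₋` form an infinite-dimensional space, so some nonzero `q`
makes `(Ad_h (z ^ k q E_jk))₊` vanish for all `j ≠ k` at once. Hence all products `h_ij (h⁻¹)_kl`
acquire a common denominator on `U₋` (`exists_common_denominator`), and likewise for `T⁻¹ h T` on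
`U₊`. That `U₊` carries infinitely many independent functions follows from the splitting itself, by
a dimension count (`not_finiteDimensional_hol_Up`).

Fixing an entry of the inverse now shows that `h` is a scalar times a meromorphic matrix on each
side, but with two unrelated scalars. They are reconciled by `f = tr (x h)`, where `x = T y T⁻¹` is
meromorphic at the centre and `y` is holomorphic on `U₊`: on either side `f` differs from the local
scalar by a meromorphic factor, so `f⁻¹ h` is meromorphic on both. Such an `x` with `f ≠ 0` exists
(`exists_isGlobalMeromorphic_trace_ne_zero`): otherwise splitting `z ^ (-j) E` for every `j` shows
that `tr (E h)` vanishes to infinite order for every `𝔤`-valued `E` on `U₋`, so `h` is a scalar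
matrix; `x = 1` gives `tr h = 0`, hence `h = 0`.

For (b) and (c), a dressed loop is both `a h c` with `a, c ∈ LG₊` and `b h d` with `b, d ∈ LG₋`.
Cancelling `f`, one sees `m'` as a two-sided translate of `m` by invertible holomorphic matrices on
`U₊`, and `g'` as such a translate of `g` near the centre. These translations preserve pole orders
and determinant orders. -/

theorem map_chart_nhdsNE {X : Type*} [TopologicalSpace X]
    (e : OpenPartialHomeomorph X ℂ) {x : X} (hx : x ∈ e.source) :
    map e (𝓝[≠] x) = 𝓝[≠] (e x) := by
  rw [e.map_nhdsWithin_eq hx]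
  apply le_antisymm
  · refine nhdsWithin_mono _ ?_
    rintro _ ⟨y, ⟨hy, hyx⟩, rfl⟩ h
    exact hyx (e.injOn hy hx h)
  · refine nhdsWithin_le_iff.2 ?_
    filter_upwards [inter_mem_nhdsWithin _ (e.open_target.mem_nhds (e.map_source hx))] with z hz
    refine ⟨e.symm z, ⟨e.map_target hz.2, ?_⟩, e.right_inv hz.2⟩
    intro h
    apply hz.1
    have : e.symm z = x := h
    rw [Set.mem_singleton_iff, ← this, e.right_inv hz.2]

theorem eventually_nhdsNE_chart {X : Type*} [TopologicalSpace X]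
    (e : OpenPartialHomeomorph X ℂ) {x : X} (hx : x ∈ e.source)
    {P : X → Prop} :
    (∀ᶠ y in 𝓝[≠] x, P y) ↔ ∀ᶠ z in 𝓝[≠] (e x), P (e.symm z) := by
  rw [← map_chart_nhdsNE e hx, eventually_map]
  have : ∀ᶠ y in 𝓝[≠] x, y ∈ e.source :=
    mem_nhdsWithin_of_mem_nhds (e.open_source.mem_nhds hx)
  constructor
  · intro h
    filter_upwards [h, this] with y h1 h2
    rwa [e.left_inv h2]
  · intro h
    filter_upwards [h, this] with y h1 h2
    rwa [e.left_inv h2] at h1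

theorem eventually_nhds_chart {X : Type*} [TopologicalSpace X]
    (e : OpenPartialHomeomorph X ℂ) {x : X} (hx : x ∈ e.source)
    {P : X → Prop} :
    (∀ᶠ y in 𝓝 x, P y) ↔ ∀ᶠ z in 𝓝 (e x), P (e.symm z) := by
  rw [← e.map_nhds_eq hx, eventually_map]
  have : ∀ᶠ y in 𝓝 x, y ∈ e.source := e.open_source.mem_nhds hx
  constructor
  · intro h
    filter_upwards [h, this] with y h1 h2
    rwa [e.left_inv h2]
  · intro h
    filter_upwards [h, this] with y h1 h2
    rwa [e.left_inv h2] at h1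

variable {X : Type*} [TopologicalSpace X] [ChartedSpace ℂ X]

/-- `F` is holomorphic near the point `x`. -/
abbrev HolAt (F : X → ℂ) (x : X) : Prop := ContMDiffAt 𝓘(ℂ) 𝓘(ℂ) ω F x

/-- Extension of a holomorphic function by zero. -/
def zeroExt {U : Opens X} (F : Hol U) : X → ℂ :=
  open Classical in fun y => if h : y ∈ U then F ⟨y, h⟩ else 0

theorem zeroExt_of_mem {U : Opens X} (F : Hol U) {y : X} (hy : y ∈ U) :
    zeroExt F y = F ⟨y, hy⟩ := dif_pos hy

theorem holAt_zeroExt {U : Opens X} (F : Hol U) {x : X} (hx : x ∈ U) : HolAt (zeroExt F) x := by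
  have h : ContMDiffAt 𝓘(ℂ) 𝓘(ℂ) ω (fun y : U => zeroExt F y) (⟨x, hx⟩ : U) := by
    have : (fun y : U => zeroExt F y) = F := funext fun y => zeroExt_of_mem F y.2
    rw [this]
    exact F.contMDiff _
  exact contMDiffAt_subtype_iff.1 h

/-- The element of `Hol U` given by a function that is holomorphic at the points of `U`. -/
def holMk {U : Opens X} (F : X → ℂ) (h : ∀ x ∈ U, HolAt F x) : Hol U :=
  ⟨fun y => F y, fun y => contMDiffAt_subtype_iff.2 (h y.1 y.2)⟩

@[simp]
theorem holMk_apply {U : Opens X} (F : X → ℂ) (h : ∀ x ∈ U, HolAt F x) (y : U) :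
    holMk F h y = F y := rfl

theorem nhdsNE_neBot_of_chartedSpace (x : X) : (𝓝[≠] x).NeBot := by
  rw [← map_neBot_iff (chartAt ℂ x), map_chart_nhdsNE _ (mem_chart_source ℂ x)]
  infer_instance

variable {F G : X → ℂ} {x : X}

theorem HolAt.pow (hF : HolAt F x) (N : ℕ) : HolAt (fun y => F y ^ N) x := ContMDiffAt.pow hF N

theorem HolAt.eq_of_eventuallyEq_nhdsNE (hF : HolAt F x) (hG : HolAt G x)
    (h : F =ᶠ[𝓝[≠] x] G) : F x = G x := by
  have := nhdsNE_neBot_of_chartedSpace x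
  exact tendsto_nhds_unique_of_eventuallyEq (hF.continuousAt.tendsto.mono_left nhdsWithin_le_nhds)
    (hG.continuousAt.tendsto.mono_left nhdsWithin_le_nhds) h

theorem MeroAt.congr (hF : MeroAt F x) (h : F =ᶠ[𝓝[≠] x] G) : MeroAt G x :=
  MeromorphicAt.congr hF ((eventually_nhdsNE_chart _ (mem_chart_source ℂ x)).1 h)

theorem ordAt_congr (h : F =ᶠ[𝓝[≠] x] G) : ordAt F x = ordAt G x :=
  meromorphicOrderAt_congr ((eventually_nhdsNE_chart _ (mem_chart_source ℂ x)).1 h)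

theorem meroAt_const (c : ℂ) : MeroAt (fun _ : X => c) x := MeromorphicAt.const c _

theorem MeroAt.mul (hF : MeroAt F x) (hG : MeroAt G x) : MeroAt (fun y => F y * G y) x :=
  MeromorphicAt.mul hF hG

theorem MeroAt.inv (hF : MeroAt F x) : MeroAt (fun y => (F y)⁻¹) x :=
  MeromorphicAt.inv hF

theorem MeroAt.sum {ι : Type*} {s : Finset ι} {F : ι → X → ℂ} (h : ∀ i ∈ s, MeroAt (F i) x) :
    MeroAt (fun y => ∑ i ∈ s, F i y) x :=
  MeromorphicAt.fun_sum h

theorem MeroAt.prod {ι : Type*} {s : Finset ι} {F : ι → X → ℂ} (h : ∀ i ∈ s, MeroAt (F i) x) :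
    MeroAt (fun y => ∏ i ∈ s, F i y) x :=
  MeromorphicAt.fun_prod h

theorem ordAt_mul (hF : MeroAt F x) (hG : MeroAt G x) :
    ordAt (fun y => F y * G y) x = ordAt F x + ordAt G x :=
  meromorphicOrderAt_mul hF hG

theorem le_ordAt_add {c : WithTop ℤ} (hF : MeroAt F x) (hG : MeroAt G x)
    (h1 : c ≤ ordAt F x) (h2 : c ≤ ordAt G x) : c ≤ ordAt (fun y => F y + G y) x :=
  (le_min h1 h2).trans (meromorphicOrderAt_add hF hG)

theorem ordAt_zero : ordAt (fun _ : X => 0) x = ⊤ := by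
  classical
  exact (meromorphicOrderAt_const (chartAt ℂ x x) (0 : ℂ)).trans (if_pos rfl)

theorem le_ordAt_sum {ι : Type*} {c : WithTop ℤ} {s : Finset ι} {F : ι → X → ℂ}
    (h : ∀ i ∈ s, MeroAt (F i) x) (h' : ∀ i ∈ s, c ≤ ordAt (F i) x) :
    c ≤ ordAt (fun y => ∑ i ∈ s, F i y) x := by
  classical
  induction s using Finset.induction_on with
  | empty => simp [ordAt_zero]
  | insert a s ha ih =>
    simp only [Finset.sum_insert ha]
    exact le_ordAt_add (h a (by simp)) (MeroAt.sum fun i hi => h i (by simp [hi]))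
      (h' a (by simp)) (ih (fun i hi => h i (by simp [hi])) fun i hi => h' i (by simp [hi]))

/-- Needed for arbitrary compatible charts, because the coordinate of the disk need not be the
preferred chart `chartAt` at its points. -/
theorem holAt_iff_analyticAt_of_mem_maximalAtlas {e : OpenPartialHomeomorph X ℂ}
    (he : e ∈ IsManifold.maximalAtlas 𝓘(ℂ) ω X) (hx : x ∈ e.source) :
    HolAt F x ↔ AnalyticAt ℂ (F ∘ e.symm) (e x) := by
  constructor
  · intro h
    have h1 : ContMDiffAt 𝓘(ℂ) 𝓘(ℂ) ω e.symm (e x) :=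
      contMDiffAt_symm_of_mem_maximalAtlas he (e.map_source hx)
    have h2 : ContMDiffAt 𝓘(ℂ) 𝓘(ℂ) ω F (e.symm (e x)) := by rwa [e.left_inv hx]
    exact (contMDiffAt_iff_contDiffAt.1 (h2.comp _ h1)).analyticAt
  · intro h
    have h1 : ContMDiffAt 𝓘(ℂ) 𝓘(ℂ) ω e x := contMDiffAt_of_mem_maximalAtlas he hx
    have h2 : ContMDiffAt 𝓘(ℂ) 𝓘(ℂ) ω (F ∘ e.symm) (e x) :=
      contMDiffAt_iff_contDiffAt.2 h.contDiffAt
    refine (h2.comp x h1).congr_of_eventuallyEq ?_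
    filter_upwards [e.open_source.mem_nhds hx] with y hy
    simp [e.left_inv hy]

variable [IsManifold 𝓘(ℂ) ω X]

theorem holAt_iff_analyticAt :
    HolAt F x ↔ AnalyticAt ℂ (F ∘ (chartAt ℂ x).symm) (chartAt ℂ x x) :=
  holAt_iff_analyticAt_of_mem_maximalAtlas (IsManifold.chart_mem_maximalAtlas x)
    (mem_chart_source ℂ x)

theorem HolAt.meroAt (h : HolAt F x) : MeroAt F x := (holAt_iff_analyticAt.1 h).meromorphicAt

theorem HolAt.ordAt_nonneg (h : HolAt F x) : 0 ≤ ordAt F x :=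
  (holAt_iff_analyticAt.1 h).meromorphicOrderAt_nonneg

theorem HolAt.ordAt_eq_zero (h : HolAt F x) (h0 : F x ≠ 0) : ordAt F x = 0 := by
  have h1 := holAt_iff_analyticAt.1 h
  rw [ordAt, h1.meromorphicOrderAt_eq, h1.analyticOrderAt_eq_zero.2]
  · rfl
  · simpa using h0

theorem HolAt.eventually_eq_zero_or_eventually_ne_zero (h : HolAt F x) :
    (∀ᶠ y in 𝓝 x, F y = 0) ∨ ∀ᶠ y in 𝓝[≠] x, F y ≠ 0 := by
  rw [eventually_nhds_chart _ (mem_chart_source ℂ x),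
    eventually_nhdsNE_chart _ (mem_chart_source ℂ x)]
  exact (holAt_iff_analyticAt.1 h).eventually_eq_zero_or_eventually_ne_zero

theorem HolAt.inv (h : HolAt F x) (h0 : F x ≠ 0) : HolAt (fun y => (F y)⁻¹) x := by
  rw [holAt_iff_analyticAt] at h ⊢
  exact h.inv (by simpa using h0)

theorem MeroAt.eventually_holAt (h : MeroAt F x) : ∀ᶠ y in 𝓝[≠] x, HolAt F y := by
  have h1 : ∀ᶠ z in 𝓝[≠] (chartAt ℂ x x), AnalyticAt ℂ (F ∘ (chartAt ℂ x).symm) z :=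
    MeromorphicAt.eventually_analyticAt h
  rw [← map_chart_nhdsNE _ (mem_chart_source ℂ x), eventually_map] at h1
  filter_upwards [h1, mem_nhdsWithin_of_mem_nhds
    ((chartAt ℂ x).open_source.mem_nhds (mem_chart_source ℂ x))] with y hy hy'
  exact (holAt_iff_analyticAt_of_mem_maximalAtlas
    (IsManifold.chart_mem_maximalAtlas x) hy').2 hy

theorem MeroAt.exists_holAt (h : MeroAt F x) (h0 : 0 ≤ ordAt F x) :
    ∃ G, HolAt G x ∧ F =ᶠ[𝓝[≠] x] G := by
  obtain ⟨g, hg, hfg⟩ := (MeromorphicAt.meromorphicOrderAt_nonneg_iff h).1 h0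
  have hx := mem_chart_source ℂ x
  have key : ∀ᶠ y in 𝓝 x, (chartAt ℂ x).symm (chartAt ℂ x y) = y := by
    filter_upwards [(chartAt ℂ x).open_source.mem_nhds hx] with y hy
    exact (chartAt ℂ x).left_inv hy
  refine ⟨g ∘ chartAt ℂ x, ?_, ?_⟩
  · have h1 : ContMDiffAt 𝓘(ℂ) 𝓘(ℂ) ω (chartAt ℂ x) x :=
      contMDiffAt_of_mem_maximalAtlas (IsManifold.chart_mem_maximalAtlas x) hx
    exact ContMDiffAt.comp x (contMDiffAt_iff_contDiffAt.2 hg.contDiffAt) h1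
  · have hfg' : ∀ᶠ z in 𝓝[≠] (chartAt ℂ x x), (F ∘ (chartAt ℂ x).symm) z = g z := hfg
    rw [← map_chart_nhdsNE _ hx, eventually_map] at hfg'
    filter_upwards [hfg', nhdsWithin_le_nhds key] with y h1 h2
    simpa [h2] using h1

theorem HolAt.eventually_holAt (h : HolAt F x) : ∀ᶠ y in 𝓝 x, HolAt F y := by
  have h1 := h.meroAt.eventually_holAt
  rw [eventually_nhdsWithin_iff] at h1
  filter_upwards [h1] with y hy
  by_cases hyx : y = x
  · rwa [hyx]
  · exact hy hyx

/-- A meromorphic function without poles extends to a holomorphic function. -/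
theorem exists_hol_of_ordAt_nonneg [T2Space X] {U : Opens X}
    (h : ∀ x ∈ U, MeroAt F x) (h' : ∀ x ∈ U, 0 ≤ ordAt F x) :
    ∃ B : Hol U, ∀ x ∈ U, F =ᶠ[𝓝[≠] x] zeroExt B := by
  classical
  have hex : ∀ x ∈ U, ∃ G, HolAt G x ∧ F =ᶠ[𝓝[≠] x] G := fun x hx =>
    (h x hx).exists_holAt (h' x hx)
  choose! G hG hFG using hex
  -- The local extensions glue along the diagonal: near `x`, both `G y` and `G x` agree with `F` on
  -- a punctured neighbourhood of `y`, hence take the same value at `y`.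
  have key : ∀ x ∈ U, (fun y => G y y) =ᶠ[𝓝 x] G x := by
    intro x hx
    have h1 := eventually_nhdsWithin_iff.1 (eventually_eventually_nhdsWithin.2 (hFG x hx))
    filter_upwards [h1, (hG x hx).eventually_holAt, U.isOpen.mem_nhds hx] with y h1 h2 hy
    by_cases hyx : y = x
    · rw [hyx]
    · refine (hG y hy).eq_of_eventuallyEq_nhdsNE h2 ?_
      have h3 := h1 hyx
      rw [isOpen_compl_singleton.nhdsWithin_eq hyx] at h3
      filter_upwards [hFG y hy, nhdsWithin_le_nhds h3] with w h4 h5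
      rw [← h4, h5]
  refine ⟨holMk (fun y => G y y) fun x hx => (hG x hx).congr_of_eventuallyEq (key x hx), ?_⟩
  intro x hx
  filter_upwards [hFG x hx, nhdsWithin_le_nhds (key x hx),
    nhdsWithin_le_nhds (U.isOpen.mem_nhds hx)] with y h1 h2 h3
  rw [zeroExt_of_mem _ h3, holMk_apply, h1, ← h2]

end toolkit

/-! ### The identity theorem and its consequences for rings of holomorphic functions. -/

section hol

variable {X : Type*} [TopologicalSpace X] [ChartedSpace ℂ X] {U V : Opens X}

/-- Evaluation of holomorphic functions at a point. -/
def evalHom (x : U) : Hol U →ₐ[ℂ] ℂ where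
  toFun F := F x
  map_one' := rfl
  map_mul' _ _ := rfl
  map_zero' := rfl
  map_add' _ _ := rfl
  commutes' _ := rfl

theorem evalHom_apply (x : U) (F : Hol U) : evalHom x F = F x := rfl

theorem hol_ext {F G : Hol U} (h : ∀ x : U, F x = G x) : F = G := ContMDiffMap.ext h

theorem evalMat_eq {n : ℕ} (M : Matrix (Fin n) (Fin n) (Hol U)) (x : U) :
    evalMat M x = (evalHom x).mapMatrix M := rfl

variable [IsManifold 𝓘(ℂ) ω X]

/-- The identity theorem. -/
theorem eventually_zeroExt_ne_zero (hU : IsPreconnected (U : Set X)) {F : Hol U} (hF : F ≠ 0)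
    {x : X} (hx : x ∈ U) : ∀ᶠ y in 𝓝[≠] x, zeroExt F y ≠ 0 := by
  by_contra hcon
  have hdich : ∀ y ∈ U, (∀ᶠ w in 𝓝 y, zeroExt F w = 0) ∨ ∀ᶠ w in 𝓝[≠] y, zeroExt F w ≠ 0 :=
    fun y hy => (holAt_zeroExt F hy).eventually_eq_zero_or_eventually_ne_zero
  -- `A` and `B` are open, disjoint and cover `U`. If the claim fails at `x`, then `x ∈ A`, so the
  -- preconnected set `U` lies in `A` and `F = 0`.
  let A : Set X := {y | ∀ᶠ w in 𝓝 y, zeroExt F w = 0}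
  let B : Set X := {y | ∀ᶠ w in 𝓝 y, w ∈ U ∧ (w ≠ y → zeroExt F w ≠ 0)}
  have hA : IsOpen A := isOpen_iff_mem_nhds.2 fun y hy => eventually_eventually_nhds.2 hy
  have hAB : ∀ y, y ∈ A → y ∉ B := by
    intro y hy hy'
    have := nhdsNE_neBot_of_chartedSpace y
    have h1 : ∀ᶠ w in 𝓝[≠] y, False := by
      rw [eventually_nhdsWithin_iff]
      filter_upwards [hy, hy'] with w h1 h2 h3 using h2.2 h3 h1
    exact h1.exists.choose_spec
  have hUAB : ∀ y ∈ U, y ∈ A ∨ y ∈ B := by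
    intro y hy
    refine (hdich y hy).imp id fun h => ?_
    filter_upwards [eventually_nhdsWithin_iff.1 h, U.isOpen.mem_nhds hy] with w h1 h2
    exact ⟨h2, h1⟩
  have hB : IsOpen B := by
    refine isOpen_iff_mem_nhds.2 fun y hy => ?_
    filter_upwards [eventually_eventually_nhds.2 hy, hy] with w h1 h2
    rcases hUAB w h2.1 with h3 | h3
    · by_cases hwy : w = y
      · rw [hwy]; exact hy
      · exact absurd h3.self_of_nhds (h2.2 hwy)
    · exact h3
  have hxA : x ∈ A := (hdich x hx).resolve_right hcon
  have hsub : (U : Set X) ⊆ A := by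
    by_contra hns
    obtain ⟨y, hy, hyA⟩ := Set.not_subset.1 hns
    obtain ⟨w, -, hwA, hwB⟩ := hU A B hA hB (fun w hw => hUAB w hw) ⟨x, hx, hxA⟩
      ⟨y, hy, (hUAB y hy).resolve_left hyA⟩
    exact hAB w hwA hwB
  refine hF (hol_ext fun y => ?_)
  have h1 : zeroExt F y = 0 := (hsub y.2).self_of_nhds
  rwa [zeroExt_of_mem F y.2] at h1

theorem hol_isDomain (hU : IsConnected (U : Set X)) : IsDomain (Hol U) := by
  obtain ⟨x, hx⟩ := hU.nonempty
  have : Nontrivial (Hol U) := ⟨0, 1, fun h => zero_ne_one (congrArg (evalHom ⟨x, hx⟩) h)⟩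
  have : NoZeroDivisors (Hol U) := by
    refine ⟨fun {F G} hFG => ?_⟩
    by_contra! h
    have := nhdsNE_neBot_of_chartedSpace x
    obtain ⟨y, hy1, hy2, hyU⟩ := ((eventually_zeroExt_ne_zero hU.isPreconnected h.1 hx).and
      ((eventually_zeroExt_ne_zero hU.isPreconnected h.2 hx).and
        (mem_nhdsWithin_of_mem_nhds (U.isOpen.mem_nhds hx)))).exists
    rw [zeroExt_of_mem F hyU] at hy1
    rw [zeroExt_of_mem G hyU] at hy2
    exact mul_ne_zero hy1 hy2 (congrArg (evalHom ⟨y, hyU⟩) hFG)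
  exact NoZeroDivisors.to_isDomain _

theorem res_injective (h : U ≤ V) (hV : IsPreconnected (V : Set X)) (hU : (U : Set X).Nonempty) :
    Function.Injective (res h) := by
  rw [injective_iff_map_eq_zero]
  intro F hF
  by_contra hne
  obtain ⟨x, hx⟩ := hU
  have := nhdsNE_neBot_of_chartedSpace x
  obtain ⟨y, hy, hyU⟩ := ((eventually_zeroExt_ne_zero hV hne (h hx)).and
    (mem_nhdsWithin_of_mem_nhds (U.isOpen.mem_nhds hx))).exists
  rw [zeroExt_of_mem F (h hyU)] at hy
  exact hy (congrArg (evalHom ⟨y, hyU⟩) hF)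

end hol

/-! ### Topology of the disk, the punctured disk and the complement of the centre. -/

section disk

variable {X : Type*} [TopologicalSpace X] [ChartedSpace ℂ X]
  (D : CoordDisk X)

theorem zero_mem_target : (0 : ℂ) ∈ D.coord.target := by simp [D.target_eq]

theorem center_mem_Um : D.center ∈ D.Um := D.coord.map_target (zero_mem_target D)

theorem coord_center : D.coord D.center = 0 := D.coord.right_inv (zero_mem_target D)

theorem coord_eq_zero_iff {y : X} (hy : y ∈ D.Um) : D.coord y = 0 ↔ y = D.center := by
  constructor
  · intro h
    exact D.coord.injOn hy (center_mem_Um D) (h.trans (coord_center D).symm)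
  · rintro rfl
    exact coord_center D

theorem isConnected_Um : IsConnected (D.Um : Set X) := by
  have h : D.coord.symm '' D.coord.target = (D.Um : Set X) := D.coord.symm_image_target_eq_source
  rw [← h, D.target_eq]
  refine IsConnected.image (Metric.isConnected_ball (by norm_num)) _ ?_
  rw [← D.target_eq]
  exact D.coord.continuousOn_symm

/-- Polar coordinates exhibit it as a continuous image of a product of two intervals. -/
theorem isConnected_ball_diff_zero : IsConnected (Metric.ball (0 : ℂ) 1 \ {0}) := by
  have h : Metric.ball (0 : ℂ) 1 \ {0} =
      (fun q : ℝ × ℝ => (q.1 : ℂ) * Complex.exp (q.2 * Complex.I)) ''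
        (Set.Ioo 0 1 ×ˢ Set.univ) := by
    ext w
    constructor
    · rintro ⟨h1, h2⟩
      refine ⟨(‖w‖, Complex.arg w), ⟨⟨norm_pos_iff.2 h2, by simpa using h1⟩, trivial⟩, ?_⟩
      exact Complex.norm_mul_exp_arg_mul_I w
    · rintro ⟨⟨r, t⟩, ⟨⟨h1, h2⟩, -⟩, rfl⟩
      have h1' : (0 : ℝ) < r := h1
      refine ⟨?_, ?_⟩
      · simpa [Complex.norm_exp_ofReal_mul_I, abs_of_pos h1'] using h2
      · simpa using h1'.ne'
  rw [h]
  refine IsConnected.image ?_ _ (by fun_prop)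
  exact ⟨⟨(1 / 2, 0), by norm_num⟩, isPreconnected_Ioo.prod isPreconnected_univ⟩

variable [T2Space X]

theorem isConnected_Upunct : IsConnected (D.Upunct : Set X) := by
  have h : D.coord.symm '' (Metric.ball (0 : ℂ) 1 \ {0}) = (D.Upunct : Set X) := by
    rw [← D.target_eq]
    ext y
    constructor
    · rintro ⟨w, ⟨hw, hw0⟩, rfl⟩
      refine ⟨D.coord.map_target hw, fun h => hw0 ?_⟩
      have h' : D.coord.symm w = D.center := h
      rw [Set.mem_singleton_iff, ← D.coord.right_inv hw, h', coord_center]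
    · rintro ⟨hy, hy'⟩
      refine ⟨D.coord y, ⟨D.coord.map_source hy, fun h => hy' ?_⟩, D.coord.left_inv hy⟩
      exact (coord_eq_zero_iff D hy).1 h
  rw [← h]
  refine IsConnected.image isConnected_ball_diff_zero _ ?_
  refine D.coord.continuousOn_symm.mono ?_
  rw [D.target_eq]
  exact Set.sdiff_subset

theorem eventually_mem_Upunct : ∀ᶠ y in 𝓝[≠] D.center, y ∈ D.Upunct := by
  filter_upwards [mem_nhdsWithin_of_mem_nhds (D.Um.isOpen.mem_nhds (center_mem_Um D)),
    self_mem_nhdsWithin] with y h1 h2 using ⟨h1, h2⟩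

/-- Given a separation of `U₊`, the connected punctured disk lies on one side. Adding the whole disk
to that side would separate the connected surface. -/
theorem isConnected_Up [ConnectedSpace X] : IsConnected (D.Up : Set X) := by
  obtain ⟨x₀, hx₀⟩ := (isConnected_Upunct D).nonempty
  refine ⟨⟨x₀, hx₀.2⟩, ?_⟩
  have hUp : ∀ y, y ∈ (D.Up : Set X) ↔ y ≠ D.center := fun y => Iff.rfl
  have key : ∀ A B : Set X, IsOpen A → IsOpen B → (D.Up : Set X) ⊆ A ∪ B →
      (D.Upunct : Set X) ⊆ A → ((D.Up : Set X) ∩ B).Nonempty →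
      ((D.Up : Set X) ∩ (A ∩ B)).Nonempty := by
    intro A B hA hB hAB hUA hne
    obtain ⟨w, hw⟩ := hne
    obtain ⟨y, -, hyA, hyB⟩ := isPreconnected_univ (α := X) (A ∪ D.Um) (B ∩ D.Up)
      (hA.union D.Um.isOpen) (hB.inter D.Up.isOpen) (by
        intro y _
        by_cases hy : y = D.center
        · exact Or.inl (Or.inr (hy ▸ center_mem_Um D))
        · rcases hAB hy with h | h
          · exact Or.inl (Or.inl h)
          · exact Or.inr ⟨h, hy⟩)
      ⟨x₀, trivial, Or.inr hx₀.1⟩ ⟨w, trivial, hw.2, hw.1⟩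
    refine ⟨y, hyB.2, ?_, hyB.1⟩
    rcases hyA with h | h
    · exact h
    · exact hUA ⟨h, hyB.2⟩
  intro A B hA hB hAB hneA hneB
  have hsub : (D.Upunct : Set X) ⊆ A ∪ B := fun y hy => hAB hy.2
  by_cases h : ((D.Upunct : Set X) ∩ (A ∩ B)).Nonempty
  · exact h.mono fun y hy => ⟨hy.1.2, hy.2⟩
  have hor : (D.Upunct : Set X) ⊆ A ∨ (D.Upunct : Set X) ⊆ B := by
    by_contra! hno
    obtain ⟨⟨a, ha, haA⟩, ⟨b, hb, hbB⟩⟩ := And.intro (Set.not_subset.1 hno.1) (Set.not_subset.1 hno.2)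
    exact h ((isConnected_Upunct D).isPreconnected A B hA hB hsub
      ⟨b, hb, (hsub hb).resolve_right hbB⟩ ⟨a, ha, (hsub ha).resolve_left haA⟩)
  rcases hor with h1 | h1
  · exact key A B hA hB hAB h1 hneB
  · rw [Set.inter_comm A B]
    exact key B A hB hA (by rwa [Set.union_comm]) h1 hneA

end disk

/-! ### Division by powers of the disk coordinate. -/

section coordinate

variable {X : Type*} [TopologicalSpace X] [ChartedSpace ℂ X] (D : CoordDisk X)

theorem holAt_coord {x : X} (hx : x ∈ D.Um) : HolAt D.coord x :=
  contMDiffAt_of_mem_maximalAtlas D.coord_mem hx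

/-- The coordinate of a coordinate disk, as a holomorphic function on the disk. -/
def coordFn : Hol D.Um := holMk D.coord fun _ hx => holAt_coord D hx

theorem coordFn_apply (y : D.Um) : coordFn D y = D.coord y := rfl

variable {D} in
/-- A holomorphic function that vanishes at the centre is divisible by the coordinate. -/
theorem exists_eq_coordFn_mul (F : Hol D.Um) (h : F ⟨D.center, center_mem_Um D⟩ = 0) :
    ∃ G, F = coordFn D * G := by
  -- In the coordinate, the quotient is the difference quotient `dslope φ 0`, which is holomorphic
  -- across `0` by the removable singularity theorem.
  let φ : ℂ → ℂ := zeroExt F ∘ D.coord.symm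
  have hφ : ∀ w ∈ D.coord.target, AnalyticAt ℂ φ w := by
    intro w hw
    have := (holAt_iff_analyticAt_of_mem_maximalAtlas D.coord_mem (D.coord.map_target hw)).1
      (holAt_zeroExt F (D.coord.map_target hw))
    rwa [D.coord.right_inv hw] at this
  have hφ0 : φ 0 = 0 := by
    change zeroExt F D.center = 0
    rw [zeroExt_of_mem F (center_mem_Um D), h]
  have hd : DifferentiableOn ℂ (dslope φ 0) D.coord.target := by
    rw [Complex.differentiableOn_dslope (D.coord.open_target.mem_nhds (zero_mem_target D))]
    exact fun w hw => (hφ w hw).differentiableAt.differentiableWithinAt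
  refine ⟨holMk (dslope φ 0 ∘ D.coord) fun x hx => ?_, hol_ext fun y => ?_⟩
  · have h1 : AnalyticAt ℂ (dslope φ 0) (D.coord x) :=
      hd.analyticAt (D.coord.open_target.mem_nhds (D.coord.map_source hx))
    exact ContMDiffAt.comp x (contMDiffAt_iff_contDiffAt.2 h1.contDiffAt) (holAt_coord D hx)
  · have h1 := sub_smul_dslope φ 0 (D.coord y)
    rw [sub_zero, hφ0, sub_zero, smul_eq_mul] at h1
    have h2 : φ (D.coord y) = F y := by
      change zeroExt F (D.coord.symm (D.coord y)) = F y
      rw [D.coord.left_inv y.2, zeroExt_of_mem F y.2]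
    rw [← h2, ← h1]
    rfl

theorem vanishingIdeal_center : vanishingIdeal D.Um D.center = Ideal.span {coordFn D} := by
  ext F
  rw [Ideal.mem_span_singleton]
  constructor
  · intro hF
    exact exists_eq_coordFn_mul F (hF _ rfl)
  · rintro ⟨G, rfl⟩ x hx
    have : coordFn D x = 0 := by
      rw [coordFn_apply, hx, coord_center]
    change coordFn D x * G x = 0
    rw [this, zero_mul]

theorem mem_vanishingIdeal_pow {k : ℕ} {F : Hol D.Um} :
    F ∈ vanishingIdeal D.Um D.center ^ k ↔ coordFn D ^ k ∣ F := by
  rw [vanishingIdeal_center, Ideal.span_singleton_pow, Ideal.mem_span_singleton]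

variable [T2Space X]

theorem coordFn_ne_zero : coordFn D ≠ 0 := by
  intro h
  obtain ⟨x, hx⟩ := (isConnected_Upunct D).nonempty
  have : coordFn D ⟨x, hx.1⟩ = 0 := by rw [h]; rfl
  exact hx.2 ((coord_eq_zero_iff D hx.1).1 this)

variable [IsManifold 𝓘(ℂ) ω X]

/-- Truncated Taylor expansion at the centre, as a system of linear functionals. -/
theorem exists_linearMap_coordFn_pow_dvd (M : ℕ) :
    ∃ L : Hol D.Um →ₗ[ℂ] (Fin M → ℂ), ∀ F, L F = 0 → coordFn D ^ M ∣ F := by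
  have := hol_isDomain (isConnected_Um D)
  let c : D.Um := ⟨D.center, center_mem_Um D⟩
  have hex : ∀ F : Hol D.Um, ∃ G, F = algebraMap ℂ _ (evalHom c F) + coordFn D * G := by
    intro F
    obtain ⟨G, hG⟩ := exists_eq_coordFn_mul (F - algebraMap ℂ _ (evalHom c F)) (by
      change evalHom c (F - algebraMap ℂ _ (evalHom c F)) = 0
      rw [map_sub, AlgHom.commutes]
      exact sub_self _)
    exact ⟨G, by rw [← hG]; ring⟩
  choose S hS using hex
  have huniq : ∀ {F G}, coordFn D * F = coordFn D * G → F = G := fun {F G} h =>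
    mul_left_cancel₀ (coordFn_ne_zero D) h
  -- `S'` is the shift `F ↦ (F - F(p)) / z`, linear because division by `z` is unique. Evaluating
  -- its iterates at the centre gives the Taylor coefficients.
  let S' : Hol D.Um →ₗ[ℂ] Hol D.Um :=
    { toFun := S
      map_add' := fun F G => huniq (by
        have h1 := hS (F + G)
        rw [map_add, map_add] at h1
        linear_combination hS F + hS G - h1)
      map_smul' := fun a F => huniq (by
        have h1 := hS (a • F)
        rw [map_smul, smul_eq_mul, map_mul, Algebra.smul_def] at h1
        rw [RingHom.id_apply, Algebra.smul_def, Algebra.smul_def]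
        linear_combination algebraMap ℂ _ a * hS F - h1) }
  refine ⟨LinearMap.pi fun i => (evalHom c).toLinearMap ∘ₗ (S' ^ (i : ℕ)), fun F hF => ?_⟩
  have key : ∀ j ≤ M, F = coordFn D ^ j * (S' ^ j) F := by
    intro j
    induction j with
    | zero => intro _; simp
    | succ j ih =>
      intro hj
      have h1 := ih (by omega)
      have h2 : evalHom c ((S' ^ j) F) = 0 := congrFun hF ⟨j, hj⟩
      have h3 := hS ((S' ^ j) F)
      rw [h2, map_zero, zero_add] at h3
      rw [h1, pow_succ', h3]
      conv_rhs => rw [← h3, ← h1]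
      rw [pow_succ' S' j]
      change _ = _ * S ((S' ^ j) F)
      ring
  exact ⟨_, key M le_rfl⟩

end coordinate

/-! ### Matrix-valued functions: pole orders and determinant orders. -/

section matrices

variable {X : Type*} [TopologicalSpace X] [ChartedSpace ℂ X] {U V : Opens X} {n : ℕ}

/-- Extension of a matrix of holomorphic functions by zero. -/
def zeroExtMat (M : Matrix (Fin n) (Fin n) (Hol U)) (y : X) : Matrix (Fin n) (Fin n) ℂ :=
  Matrix.of fun i j => zeroExt (M i j) y

/-- The entries of a matrix-valued function are holomorphic near `x`. -/
def MatHolAt (M : X → Matrix (Fin n) (Fin n) ℂ) (x : X) : Prop :=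
  ∀ i j, HolAt (fun y => M y i j) x

theorem matHolAt_zeroExtMat (M : Matrix (Fin n) (Fin n) (Hol U)) {x : X} (hx : x ∈ U) :
    MatHolAt (zeroExtMat M) x := fun i j => holAt_zeroExt (M i j) hx

variable {M N A B : X → Matrix (Fin n) (Fin n) ℂ} {x : X}

theorem MatHolAt.mul (hM : MatHolAt M x) (hN : MatHolAt N x) :
    MatHolAt (fun y => M y * N y) x := by
  intro i j
  simp only [Matrix.mul_apply]
  exact contMDiffAt_finsetSum fun k _ => (hM i k).mul (hN k j)

theorem MatHolAt.eq_of_eventuallyEq (hM : MatHolAt M x) (hN : MatHolAt N x)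
    (h : M =ᶠ[𝓝[≠] x] N) : M x = N x := by
  ext i j
  exact (hM i j).eq_of_eventuallyEq_nhdsNE (hN i j) (h.mono fun y hy => by
    change M y i j = N y i j
    rw [hy])

theorem MatMeroAt.mul (hM : MatMeroAt M x) (hN : MatMeroAt N x) :
    MatMeroAt (fun y => M y * N y) x := by
  intro i j
  simp only [Matrix.mul_apply]
  exact MeroAt.sum fun k _ => (hM i k).mul (hN k j)

theorem MatMeroAt.congr (hM : MatMeroAt M x) (h : M =ᶠ[𝓝[≠] x] N) : MatMeroAt N x :=
  fun i j => (hM i j).congr (h.mono fun y hy => by simp only [hy])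

theorem MatMeroAt.det (hM : MatMeroAt M x) : MeroAt (fun y => (M y).det) x := by
  simp only [Matrix.det_apply']
  exact MeroAt.sum fun σ _ => (meroAt_const _).mul (MeroAt.prod fun i _ => hM _ _)

/-- Cramer's rule. Invertibility is not required, since the formula `det⁻¹ • adjugate` also holds,
with value `0`, where the determinant vanishes. -/
theorem MatMeroAt.inv (hM : MatMeroAt M x) : MatMeroAt (fun y => (M y)⁻¹) x := by
  intro i j
  simp only [Matrix.inv_def, Matrix.smul_apply, smul_eq_mul, Ring.inverse_eq_inv',
    Matrix.adjugate_apply]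
  refine hM.det.inv.mul (MatMeroAt.det fun k l => ?_)
  by_cases hk : k = j
  · subst hk
    simpa using meroAt_const _
  · simpa [Matrix.updateRow_ne hk] using hM k l

theorem le_ordAt_matMul {c d : WithTop ℤ} (hM : MatMeroAt M x) (hN : MatMeroAt N x)
    (h1 : ∀ i j, c ≤ ordAt (fun y => M y i j) x) (h2 : ∀ i j, d ≤ ordAt (fun y => N y i j) x)
    (i j : Fin n) : c + d ≤ ordAt (fun y => (M y * N y) i j) x := by
  simp only [Matrix.mul_apply]
  refine le_ordAt_sum (fun k _ => (hM i k).mul (hN k j)) fun k _ => ?_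
  rw [ordAt_mul (hM i k) (hN k j)]
  exact add_le_add (h1 i k) (h2 k j)

theorem poleOrder_congr (h : M =ᶠ[𝓝[≠] x] N) : poleOrder M x = poleOrder N x := by
  have key : ∀ i j, ordAt (fun y => M y i j) x = ordAt (fun y => N y i j) x := fun i j =>
    ordAt_congr (h.mono fun y hy => by simp only [hy])
  simp only [poleOrder, key]

theorem detOrd_congr (h : M =ᶠ[𝓝[≠] x] N) : detOrd M x = detOrd N x :=
  ordAt_congr (h.mono fun y hy => by simp only [hy])

/-- An entry vanishing near `x` has order `⊤`, and `untop₀` sends `⊤` to `0`, so such an entry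
correctly contributes no pole. -/
theorem poleOrder_le_iff {c : ℕ} :
    poleOrder M x ≤ c ↔ ∀ i j, ((-(c : ℤ) : ℤ) : WithTop ℤ) ≤ ordAt (fun y => M y i j) x := by
  simp only [poleOrder, Finset.sup_le_iff, Finset.mem_univ, true_imp_iff]
  refine forall_congr' fun i => forall_congr' fun j => ?_
  induction ordAt (fun y => M y i j) x with
  | top => simp
  | coe a =>
    rw [WithTop.untop₀_coe, WithTop.coe_le_coe]
    omega

theorem neg_poleOrder_le (i j : Fin n) :
    ((-(poleOrder M x : ℤ) : ℤ) : WithTop ℤ) ≤ ordAt (fun y => M y i j) x :=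
  poleOrder_le_iff.1 le_rfl i j

theorem MatHolAt.det (hM : MatHolAt M x) : HolAt (fun y => (M y).det) x := by
  simp only [Matrix.det_apply']
  exact contMDiffAt_finsetSum fun σ _ => contMDiffAt_const.mul
    (contMDiffAt_finsetProd fun i _ => hM _ _)

theorem zeroExtMat_of_mem (M : Matrix (Fin n) (Fin n) (Hol U)) {y : X} (hy : y ∈ U) :
    zeroExtMat M y = evalMat M ⟨y, hy⟩ := by
  ext i j
  exact zeroExt_of_mem _ hy

theorem evalMat_mul (M N : Matrix (Fin n) (Fin n) (Hol U)) (y : U) :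
    evalMat (M * N) y = evalMat M y * evalMat N y := by
  simp only [evalMat_eq, map_mul]

theorem evalMat_one (y : U) : evalMat (1 : Matrix (Fin n) (Fin n) (Hol U)) y = 1 := by
  simp only [evalMat_eq, map_one]

theorem evalMat_inv_mul (a : GL (Fin n) (Hol U)) (y : U) :
    evalMat (a⁻¹).1 y * evalMat a.1 y = 1 := by
  rw [← evalMat_mul, ← Units.val_mul, inv_mul_cancel, Units.val_one, evalMat_one]

theorem evalMat_mul_inv (a : GL (Fin n) (Hol U)) (y : U) :
    evalMat a.1 y * evalMat (a⁻¹).1 y = 1 := by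
  rw [← evalMat_mul, ← Units.val_mul, mul_inv_cancel, Units.val_one, evalMat_one]

theorem zeroExtMat_inv_mul (a : GL (Fin n) (Hol U)) {y : X} (hy : y ∈ U) :
    zeroExtMat (a⁻¹).1 y * zeroExtMat a.1 y = 1 := by
  rw [zeroExtMat_of_mem _ hy, zeroExtMat_of_mem _ hy, evalMat_inv_mul]

theorem zeroExtMat_mul_inv (a : GL (Fin n) (Hol U)) {y : X} (hy : y ∈ U) :
    zeroExtMat a.1 y * zeroExtMat (a⁻¹).1 y = 1 := by
  rw [zeroExtMat_of_mem _ hy, zeroExtMat_of_mem _ hy, evalMat_mul_inv]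

theorem det_zeroExtMat_ne_zero (a : GL (Fin n) (Hol U)) {y : X} (hy : y ∈ U) :
    (zeroExtMat a.1 y).det ≠ 0 := by
  intro h
  have := congrArg Matrix.det (zeroExtMat_mul_inv a hy)
  rw [Matrix.det_mul, h, zero_mul, Matrix.det_one] at this
  exact zero_ne_one this

variable [IsManifold 𝓘(ℂ) ω X]

theorem MatHolAt.matMeroAt (hM : MatHolAt M x) : MatMeroAt M x := fun i j => (hM i j).meroAt

theorem MatHolAt.ordAt_nonneg (hM : MatHolAt M x) (i j : Fin n) :
    0 ≤ ordAt (fun y => M y i j) x := (hM i j).ordAt_nonneg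

theorem MatHolAt.poleOrder_eq_zero (hM : MatHolAt M x) : poleOrder M x = 0 := by
  rw [← Nat.le_zero, poleOrder_le_iff]
  simpa using hM.ordAt_nonneg

theorem MatMeroAt.eventually_matHolAt (hM : MatMeroAt M x) :
    ∀ᶠ y in 𝓝[≠] x, MatHolAt M y := by
  simp only [MatHolAt, eventually_all]
  exact fun i j => (hM i j).eventually_holAt

theorem poleOrder_mul_mul_le (hA : MatHolAt A x) (hB : MatHolAt B x) (hM : MatMeroAt M x) :
    poleOrder (fun y => A y * M y * B y) x ≤ poleOrder M x := by
  rw [poleOrder_le_iff]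
  intro i j
  have h := le_ordAt_matMul (hA.matMeroAt.mul hM) hB.matMeroAt
    (le_ordAt_matMul hA.matMeroAt hM hA.ordAt_nonneg neg_poleOrder_le) hB.ordAt_nonneg i j
  rwa [zero_add, add_zero] at h

theorem detOrd_mul_mul (hA : MatHolAt A x) (hB : MatHolAt B x) (hM : MatMeroAt M x)
    (hA0 : (A x).det ≠ 0) (hB0 : (B x).det ≠ 0) :
    detOrd (fun y => A y * M y * B y) x = detOrd M x := by
  unfold detOrd
  simp only [Matrix.det_mul]
  rw [ordAt_mul (hA.det.meroAt.mul hM.det) hB.det.meroAt, ordAt_mul hA.det.meroAt hM.det,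
    hA.det.ordAt_eq_zero hA0, hB.det.ordAt_eq_zero hB0, zero_add, add_zero]

/-- Holomorphic factors cannot raise the pole order; applying this to the inverse factors as well
gives equality. -/
theorem poleOrder_mul_mul (a b : GL (Fin n) (Hol U)) (hx : x ∈ U) (hM : MatMeroAt M x) :
    poleOrder (fun y => zeroExtMat a.1 y * M y * zeroExtMat b.1 y) x = poleOrder M x := by
  have h1 := matHolAt_zeroExtMat a.1 hx
  have h2 := matHolAt_zeroExtMat b.1 hx
  refine le_antisymm (poleOrder_mul_mul_le h1 h2 hM) ?_
  refine le_of_eq_of_le ?_ (poleOrder_mul_mul_le (matHolAt_zeroExtMat (a⁻¹).1 hx)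
    (matHolAt_zeroExtMat (b⁻¹).1 hx) ((h1.matMeroAt.mul hM).mul h2.matMeroAt))
  refine poleOrder_congr ?_
  filter_upwards [mem_nhdsWithin_of_mem_nhds (U.isOpen.mem_nhds hx)] with y hy
  have e1 := zeroExtMat_inv_mul a hy
  have e2 := zeroExtMat_mul_inv b hy
  rw [show zeroExtMat (a⁻¹).1 y * (zeroExtMat a.1 y * M y * zeroExtMat b.1 y) *
      zeroExtMat (b⁻¹).1 y = (zeroExtMat (a⁻¹).1 y * zeroExtMat a.1 y) * M y *
      (zeroExtMat b.1 y * zeroExtMat (b⁻¹).1 y) by noncomm_ring, e1, e2, one_mul, mul_one]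

theorem detOrd_mul_mul_units (a b : GL (Fin n) (Hol U)) (hx : x ∈ U) (hM : MatMeroAt M x) :
    detOrd (fun y => zeroExtMat a.1 y * M y * zeroExtMat b.1 y) x = detOrd M x :=
  detOrd_mul_mul (matHolAt_zeroExtMat a.1 hx) (matHolAt_zeroExtMat b.1 hx) hM
    (det_zeroExtMat_ne_zero a hx) (det_zeroExtMat_ne_zero b hx)

end matrices

/-! ### Invariance of poles and determinant zeros under dressing. -/

section dressing

variable {X : Type*} [TopologicalSpace X] [T2Space X] [ChartedSpace ℂ X]
  {D : CoordDisk X} {n : ℕ} {G : StructureGroup} {k : ℕ} {T : LGL D n}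

theorem exists_of_mem_groupPlus {a : LGL D n} (ha : a ∈ groupPlus D G T) :
    ∃ α : GL (Fin n) (Hol D.Up), ∀ (y : X) (hy : y ∈ D.Upunct),
      evalMat a.1 ⟨y, hy⟩ =
        zeroExtMat T.1 y * zeroExtMat α.1 y * zeroExtMat (T⁻¹).1 y := by
  obtain ⟨_, ⟨α, -, rfl⟩, rfl⟩ := ha
  refine ⟨α, fun y hy => ?_⟩
  rw [zeroExtMat_of_mem _ hy, zeroExtMat_of_mem _ hy, zeroExtMat_of_mem _ hy.2]
  change evalMat (T.1 * _ * (T⁻¹).1) _ = _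
  rw [evalMat_mul, evalMat_mul]
  rfl

theorem exists_of_mem_groupMinus {b : LGL D n} (hb : b ∈ groupMinus D n G k) :
    ∃ β : GL (Fin n) (Hol D.Um), ∀ (y : X) (hy : y ∈ D.Upunct),
      evalMat b.1 ⟨y, hy⟩ = zeroExtMat β.1 y := by
  obtain ⟨β, -, rfl⟩ := hb
  refine ⟨β, fun y hy => ?_⟩
  rw [zeroExtMat_of_mem _ hy.1]
  rfl

/-- The first presentation controls `h'` on `U₊`, the second controls it at the centre. -/
theorem exists_of_mem_dressingOrbit {h h' : LGL D n} (hh : h' ∈ dressingOrbit D G k T h) :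
    (∃ a ∈ groupPlus D G T, ∃ c ∈ groupPlus D G T, h' = a * h * c) ∧
      ∃ b ∈ groupMinus D n G k, ∃ d ∈ groupMinus D n G k, h' = b * h * d := by
  obtain ⟨c, hc, d, hd, a, ha, b, hb, e, rfl⟩ := hh
  refine ⟨⟨a⁻¹, inv_mem ha, c, hc, rfl⟩, ⟨b⁻¹, inv_mem hb, d, hd, ?_⟩⟩
  have e' : h * c = a * b⁻¹ * h * d := by rw [← e]; group
  rw [mul_assoc, e']
  group

variable {h : LGL D n} {f : X → ℂ} {g m : X → Matrix (Fin n) (Fin n) ℂ}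

/-- A zero of `f` where `h = f g` would force `det h = 0`. For `n = 0` the determinant is `1` and
nothing constrains `f`. -/
theorem IsScalarTimesMeromorphic.eventually_ne_zero [NeZero n]
    (H : IsScalarTimesMeromorphic D T h f g m) {x : X} (hx : x ∈ D.Upunct) :
    ∀ᶠ y in 𝓝[≠] x, y ∈ D.Upunct ∧ f y ≠ 0 ∧ zeroExtMat h.1 y = f y • g y := by
  filter_upwards [H.eq_mul x hx, mem_nhdsWithin_of_mem_nhds (D.Upunct.isOpen.mem_nhds hx)]
    with y h1 hy
  have h2 := h1 hy
  rw [← zeroExtMat_of_mem _ hy] at h2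
  refine ⟨hy, fun h0 => det_zeroExtMat_ne_zero h hy ?_, h2⟩
  rw [h2, h0, zero_smul, Matrix.det_zero]

variable [IsManifold 𝓘(ℂ) ω X]

/-- Relations between translates of `h` near the centre hold for `g` as well. -/
theorem IsScalarTimesMeromorphic.eventually_eq [NeZero n]
    (H : IsScalarTimesMeromorphic D T h f g m) {A B C E : X → Matrix (Fin n) (Fin n) ℂ}
    (hA : ∀ y ∈ D.Upunct, MatHolAt A y) (hB : ∀ y ∈ D.Upunct, MatHolAt B y)
    (hC : ∀ y ∈ D.Upunct, MatHolAt C y) (hE : ∀ y ∈ D.Upunct, MatHolAt E y)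
    (e : ∀ y ∈ D.Upunct, A y * zeroExtMat h.1 y * B y = C y * zeroExtMat h.1 y * E y) :
    ∀ᶠ y in 𝓝[≠] D.center, A y * g y * B y = C y * g y * E y := by
  -- The equation `h = f g` is available only on punctured neighbourhoods. Since `g` is holomorphic
  -- at `x`, the relation obtained there by cancelling `f` extends to `x` by continuity.
  filter_upwards [H.mero_center.eventually_matHolAt, eventually_mem_Upunct D] with x hgx hx
  refine MatHolAt.eq_of_eventuallyEq (((hA x hx).mul hgx).mul (hB x hx))
    (((hC x hx).mul hgx).mul (hE x hx)) ?_
  filter_upwards [H.eventually_ne_zero hx] with y hy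
  obtain ⟨hy, hf, hyh⟩ := hy
  have h1 := e y hy
  rw [hyh] at h1
  simp only [Matrix.mul_smul, Matrix.smul_mul] at h1
  exact smul_right_injective _ hf h1

theorem IsScalarTimesMeromorphic.dressing [NeZero n]
    (H : IsScalarTimesMeromorphic D T h f g m) {h' : LGL D n}
    (hh : h' ∈ dressingOrbit D G k T h) :
    ∃ g' m' : X → Matrix (Fin n) (Fin n) ℂ, IsScalarTimesMeromorphic D T h' f g' m' ∧
      (poleOrder g' D.center = poleOrder g D.center ∧
        ∀ x ∈ D.Up, poleOrder m' x = poleOrder m x) ∧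
      (detOrd g' D.center = detOrd g D.center ∧ ∀ x ∈ D.Up, detOrd m' x = detOrd m x) := by
  obtain ⟨⟨a, ha, c, hc, e1⟩, ⟨b, hb, d, hd, e2⟩⟩ := exists_of_mem_dressingOrbit hh
  obtain ⟨α, hα⟩ := exists_of_mem_groupPlus ha
  obtain ⟨γ, hγ⟩ := exists_of_mem_groupPlus hc
  obtain ⟨β, hβ⟩ := exists_of_mem_groupMinus hb
  obtain ⟨δ, hδ⟩ := exists_of_mem_groupMinus hd
  -- `m'` is defined first and `g'` from it, so that the conjugation relation holds at every point
  -- of the punctured disk and not only generically.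
  let m' : X → Matrix (Fin n) (Fin n) ℂ := fun y => zeroExtMat α.1 y * m y * zeroExtMat γ.1 y
  let g' : X → Matrix (Fin n) (Fin n) ℂ := fun y =>
    zeroExtMat T.1 y * m' y * zeroExtMat (T⁻¹).1 y
  have hm : ∀ y ∈ D.Upunct, m y = zeroExtMat (T⁻¹).1 y * g y * zeroExtMat T.1 y := by
    intro y hy
    rw [zeroExtMat_of_mem _ hy, zeroExtMat_of_mem _ hy]
    exact H.conj_eq ⟨y, hy⟩
  have hg' : ∀ y ∈ D.Upunct, g' y = zeroExtMat a.1 y * g y * zeroExtMat c.1 y := by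
    intro y hy
    simp only [g', m', hm y hy]
    rw [zeroExtMat_of_mem a.1 hy, zeroExtMat_of_mem c.1 hy, hα y hy, hγ y hy]
    noncomm_ring
  have hge : ∀ᶠ y in 𝓝[≠] D.center, g' y = zeroExtMat β.1 y * g y * zeroExtMat δ.1 y := by
    have h1 := H.eventually_eq (A := zeroExtMat a.1) (B := zeroExtMat c.1)
      (C := zeroExtMat β.1) (E := zeroExtMat δ.1)
      (fun y hy => matHolAt_zeroExtMat _ hy) (fun y hy => matHolAt_zeroExtMat _ hy)
      (fun y hy => matHolAt_zeroExtMat _ hy.1) (fun y hy => matHolAt_zeroExtMat _ hy.1) (by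
        intro y hy
        rw [← hβ y hy, ← hδ y hy, zeroExtMat_of_mem _ hy, zeroExtMat_of_mem _ hy,
          zeroExtMat_of_mem _ hy, ← evalMat_mul, ← evalMat_mul, ← evalMat_mul, ← evalMat_mul,
          ← Units.val_mul, ← Units.val_mul, ← Units.val_mul, ← Units.val_mul, ← e1, ← e2])
    filter_upwards [h1, eventually_mem_Upunct D] with y h1 hy
    rw [hg' y hy, h1]
  have hp : ∀ x ∈ D.Up, poleOrder m' x = poleOrder m x := fun x hx =>
    poleOrder_mul_mul α γ hx (H.mero x hx)
  refine ⟨g', m', ⟨H.scalar_mero, fun x hx => ?_, ?_, ?_, ?_, ?_⟩, ⟨?_, hp⟩, ⟨?_, fun x hx =>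
    detOrd_mul_mul_units α γ hx (H.mero x hx)⟩⟩
  · filter_upwards [H.eq_mul x hx] with y hy hyU
    rw [hg' y hyU, e1, Units.val_mul, Units.val_mul, evalMat_mul, evalMat_mul, hy hyU,
      zeroExtMat_of_mem _ hyU, zeroExtMat_of_mem _ hyU]
    simp only [Matrix.mul_smul, Matrix.smul_mul]
  · exact (((matHolAt_zeroExtMat β.1 (center_mem_Um D)).matMeroAt.mul H.mero_center).mul
      (matHolAt_zeroExtMat δ.1 (center_mem_Um D)).matMeroAt).congr (hge.mono fun y hy => hy.symm)
  · intro y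
    rw [← zeroExtMat_of_mem _ y.2, ← zeroExtMat_of_mem _ y.2]
    have t1 := zeroExtMat_inv_mul T y.2
    simp only [g']
    rw [show zeroExtMat (T⁻¹).1 y.1 * (zeroExtMat T.1 y.1 * m' y * zeroExtMat (T⁻¹).1 y.1) *
      zeroExtMat T.1 y.1 = (zeroExtMat (T⁻¹).1 y.1 * zeroExtMat T.1 y.1) * m' y *
      (zeroExtMat (T⁻¹).1 y.1 * zeroExtMat T.1 y.1) by noncomm_ring, t1, one_mul, mul_one]
  · exact fun x hx => ((matHolAt_zeroExtMat α.1 hx).matMeroAt.mul (H.mero x hx)).mul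
      (matHolAt_zeroExtMat γ.1 hx).matMeroAt
  · refine H.finite_poles.subset fun x hx => ⟨hx.1, ?_⟩
    rw [← hp x hx.1]
    exact hx.2
  · rw [poleOrder_congr hge, poleOrder_mul_mul β δ (center_mem_Um D) H.mero_center]
  · rw [detOrd_congr hge, detOrd_mul_mul_units β δ (center_mem_Um D) H.mero_center]

end dressing

/-! ### Linear algebra of subspaces of finite codimension. -/

section linear

variable {A M W : Type*} [AddCommGroup A] [Module ℂ A] [AddCommGroup M] [Module ℂ M]
  [AddCommGroup W] [Module ℂ W]

theorem finiteDimensional_range_of_le_ker {S : Submodule ℂ A} [FiniteDimensional ℂ (A ⧸ S)]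
    (F : A →ₗ[ℂ] W) (h : S ≤ LinearMap.ker F) : FiniteDimensional ℂ (LinearMap.range F) := by
  rw [← Submodule.range_liftQ S F h]
  infer_instance

theorem finiteDimensional_quotient_ker {E : Type*} [AddCommGroup E] [Module ℂ E]
    [FiniteDimensional ℂ E] (L : A →ₗ[ℂ] E) : FiniteDimensional ℂ (A ⧸ LinearMap.ker L) :=
  L.quotKerEquivRange.symm.finiteDimensional

/-- The shape `(S.map ρ).comap N.subtype` is that of `loopPlus` and `loopMinus`. The map `φ` factors
through a quotient by parameters in the finite-codimensional `S'`. -/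
theorem finiteDimensional_map_comap (S S' : Submodule ℂ A) [FiniteDimensional ℂ (A ⧸ S')]
    (ρ : A →ₗ[ℂ] M) (N : Submodule ℂ M) (φ : N →ₗ[ℂ] W)
    (hφ : ∀ a ∈ S, a ∈ S' → ∀ ξ : N, (ξ : M) = ρ a → φ ξ = 0) :
    FiniteDimensional ℂ (((S.map ρ).comap N.subtype).map φ) := by
  let Q : Submodule ℂ A := S ⊓ N.comap ρ
  let ψ : Q →ₗ[ℂ] N := (ρ ∘ₗ Q.subtype).codRestrict N fun c => c.2.2
  have := finiteDimensional_quotient_ker (S'.mkQ ∘ₗ Q.subtype)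
  have hfin := finiteDimensional_range_of_le_ker (S := LinearMap.ker (S'.mkQ ∘ₗ Q.subtype))
    (φ ∘ₗ ψ) (by
      intro a ha
      have ha' : (a : A) ∈ S' := by simpa using ha
      exact hφ a a.2.1 ha' _ rfl)
  refine Submodule.finiteDimensional_of_le (S₂ := LinearMap.range (φ ∘ₗ ψ)) ?_
  rintro _ ⟨ξ, ⟨a, ha, hξ⟩, rfl⟩
  have haN : ρ a ∈ N := by rw [hξ]; exact ξ.2
  refine ⟨⟨a, ha, haN⟩, ?_⟩
  exact congrArg φ (Subtype.ext hξ)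

end linear

/-! ### Vanishing to prescribed orders, and removal of poles. -/

section taylor

variable {X : Type*} [TopologicalSpace X] [ChartedSpace ℂ X] [IsManifold 𝓘(ℂ) ω X]
  {U : Opens X} {F : X → ℂ} {x : X}

theorem HolAt.natCast_le_ordAt (hF : HolAt F x) {N : ℕ}
    (h : ∀ i < N, iteratedDeriv i (F ∘ (chartAt ℂ x).symm) (chartAt ℂ x x) = 0) :
    ((N : ℤ) : WithTop ℤ) ≤ ordAt F x := by
  have h1 := holAt_iff_analyticAt.1 hF
  have h2 := (natCast_le_analyticOrderAt_iff_iteratedDeriv_eq_zero h1).2 h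
  rw [ordAt, h1.meromorphicOrderAt_eq]
  generalize analyticOrderAt (F ∘ (chartAt ℂ x).symm) (chartAt ℂ x x) = o at h2
  cases o with
  | top => simp
  | coe a =>
    have h3 : N ≤ a := by exact_mod_cast h2
    change ((N : ℤ) : WithTop ℤ) ≤ ((a : ℤ) : WithTop ℤ)
    exact_mod_cast h3

theorem HolAt.one_le_ordAt (hF : HolAt F x) (h : F x = 0) : 1 ≤ ordAt F x := by
  refine HolAt.natCast_le_ordAt (N := 1) hF fun i hi => ?_
  obtain rfl : i = 0 := by omega
  simpa using h

theorem exists_linearMap_le_ordAt (hx : x ∈ U) (N : ℕ) :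
    ∃ L : Hol U →ₗ[ℂ] (Fin N → ℂ), ∀ F, L F = 0 →
      ((N : ℤ) : WithTop ℤ) ≤ ordAt (zeroExt F) x := by
  have hd : ∀ (F : Hol U) (i : ℕ), ContDiffAt ℂ i (zeroExt F ∘ (chartAt ℂ x).symm)
      (chartAt ℂ x x) := fun F i => (holAt_iff_analyticAt.1 (holAt_zeroExt F hx)).contDiffAt
  refine ⟨LinearMap.pi fun i : Fin N =>
    { toFun := fun F => iteratedDeriv i (zeroExt F ∘ (chartAt ℂ x).symm) (chartAt ℂ x x)
      map_add' := fun F G => ?_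
      map_smul' := fun c F => ?_ }, fun F hF => (holAt_zeroExt F hx).natCast_le_ordAt fun i hi => ?_⟩
  · rw [← iteratedDeriv_add (hd F i) (hd G i)]
    congr 1
    funext w
    simp only [Function.comp_apply, Pi.add_apply, zeroExt]
    split_ifs <;> simp
  · rw [RingHom.id_apply, ← iteratedDeriv_const_smul (hd F i)]
    congr 1
    funext w
    simp only [Function.comp_apply, Pi.smul_apply, zeroExt]
    split_ifs <;> simp
  · exact congrFun hF ⟨i, hi⟩

/-- Vanishing to prescribed orders at finitely many points is a condition of finite codimension. -/
theorem exists_submodule_le_ordAt {n : ℕ} (N : X → ℕ) (hN : {x | x ∈ U ∧ 0 < N x}.Finite) :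
    ∃ S : Submodule ℂ (Matrix (Fin n) (Fin n) (Hol U)), FiniteDimensional ℂ (_ ⧸ S) ∧
      ∀ a ∈ S, ∀ x ∈ U, ∀ i j, ((N x : ℤ) : WithTop ℤ) ≤ ordAt (fun y => zeroExtMat a y i j) x := by
  choose L hL using fun x : {x // x ∈ U ∧ 0 < N x} => exists_linearMap_le_ordAt x.2.1 (N x)
  have : Finite {x // x ∈ U ∧ 0 < N x} := hN
  let Λ : Matrix (Fin n) (Fin n) (Hol U) →ₗ[ℂ]
      ((x : {x // x ∈ U ∧ 0 < N x}) → Fin n → Fin n → Fin (N x) → ℂ) :=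
    LinearMap.pi fun x => LinearMap.pi fun i => LinearMap.pi fun j =>
      L x ∘ₗ Matrix.entryLinearMap ℂ (Hol U) i j
  refine ⟨LinearMap.ker Λ, finiteDimensional_quotient_ker Λ, fun a ha x hx i j => ?_⟩
  rcases Nat.eq_zero_or_pos (N x) with h0 | h0
  · rw [h0]
    exact (holAt_zeroExt (a i j) hx).ordAt_nonneg
  · exact hL ⟨x, hx, h0⟩ (a i j) (congrFun (congrFun (congrFun ha ⟨x, hx, h0⟩) i) j)

omit [ChartedSpace ℂ X] [IsManifold 𝓘(ℂ) ω X] in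
theorem finite_of_forall_eventually_notMem [CompactSpace X] {S : Set X}
    (h : ∀ x, ∀ᶠ y in 𝓝[≠] x, y ∉ S) : S.Finite := by
  by_contra hS
  obtain ⟨x, hx⟩ := Set.Infinite.exists_accPt_principal hS
  rw [accPt_iff_frequently_nhdsNE] at hx
  exact hx (h x)

variable [T2Space X]

theorem exists_holMat_of_ordAt_nonneg {n : ℕ} {M : X → Matrix (Fin n) (Fin n) ℂ}
    (hM : ∀ x ∈ U, MatMeroAt M x) (h : ∀ x ∈ U, ∀ i j, 0 ≤ ordAt (fun y => M y i j) x) :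
    ∃ b : Matrix (Fin n) (Fin n) (Hol U), ∀ x ∈ U, M =ᶠ[𝓝[≠] x] zeroExtMat b := by
  choose b hb using fun i j => exists_hol_of_ordAt_nonneg (U := U) (F := fun y => M y i j)
    (fun x hx => hM x hx i j) (fun x hx => h x hx i j)
  refine ⟨Matrix.of b, fun x hx => ?_⟩
  have : ∀ᶠ y in 𝓝[≠] x, ∀ i j, M y i j = zeroExt (b i j) y := by
    simp only [eventually_all]
    exact fun i j => hb i j x hx
  filter_upwards [this] with y hy
  ext i j
  exact hy i j

end taylor

/-! ### Sufficiency in (a): loops of the stated form have finite-dimensional leaves. -/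

section leaf

variable {X : Type*} [TopologicalSpace X] [T2Space X] [ChartedSpace ℂ X]
  {D : CoordDisk X} {n : ℕ} {G : StructureGroup} {k : ℕ} {T : LGL D n}

/-- Restriction from the complement of the centre to the punctured disk. -/
def resUp (D : CoordDisk X) : Hol D.Up →ₐ[ℂ] Hol D.Upunct := res inf_le_right

/-- Restriction from the disk to the punctured disk. -/
def resUm (D : CoordDisk X) : Hol D.Um →ₐ[ℂ] Hol D.Upunct := res inf_le_left

theorem evalMat_map_resUp (M : Matrix (Fin n) (Fin n) (Hol D.Up)) {y : X} (hy : y ∈ D.Upunct) :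
    evalMat ((resUp D).mapMatrix M) ⟨y, hy⟩ = evalMat M ⟨y, hy.2⟩ := rfl

theorem evalMat_map_resUm (M : Matrix (Fin n) (Fin n) (Hol D.Um)) {y : X} (hy : y ∈ D.Upunct) :
    evalMat ((resUm D).mapMatrix M) ⟨y, hy⟩ = evalMat M ⟨y, hy.1⟩ := rfl

omit [T2Space X] in
theorem holMat_ext {U : Opens X} {a b : Matrix (Fin n) (Fin n) (Hol U)}
    (h : ∀ y (hy : y ∈ U), evalMat a ⟨y, hy⟩ = evalMat b ⟨y, hy⟩) : a = b := by
  ext i j y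
  exact congrFun (congrFun (h y.1 y.2) i) j

theorem mem_loopPlus {ξ : loopAlg D n G} : ξ ∈ loopPlus D G T ↔
    ∃ a ∈ G.lie n (Hol D.Up),
      T.1 * (resUp D).mapMatrix a * (T⁻¹).1 = ξ.1 := Iff.rfl

theorem mem_loopMinus {ξ : loopAlg D n G} : ξ ∈ loopMinus D n G k ↔
    ∃ a ∈ G.lie n (Hol D.Um), (∀ i j, coordFn D ^ k ∣ a i j) ∧
      (resUm D).mapMatrix a = ξ.1 := by
  constructor
  · rintro ⟨a, ⟨h1, h2⟩, h3⟩
    refine ⟨a, h1, fun i j => ?_, h3⟩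
    exact (mem_vanishingIdeal_pow D).1 ((Ideal.mem_matrix _ _ _).1 h2 i j)
  · rintro ⟨a, h1, h2, h3⟩
    refine ⟨a, ⟨h1, (Ideal.mem_matrix _ _ _).2 fun i j => ?_⟩, h3⟩
    exact (mem_vanishingIdeal_pow D).2 (h2 i j)

/-- The trace commutes with ring maps, so tracelessness can be tested after an injective
restriction. -/
theorem lie_of_map_mem {R S : Type*} [CommRing R] [CommRing S] [Algebra ℂ R] [Algebra ℂ S]
    {φ : R →ₐ[ℂ] S} (hφ : Function.Injective φ) {a : Matrix (Fin n) (Fin n) R}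
    (h : φ.mapMatrix a ∈ G.lie n S) : a ∈ G.lie n R := by
  cases G with
  | gl => trivial
  | sl =>
    have h1 : Matrix.trace (φ.mapMatrix a) = 0 := h
    change Matrix.trace a = 0
    apply hφ
    rw [map_zero, ← h1, AddMonoidHom.map_trace φ a]
    rfl

theorem Ad_val (h : LGL D n) (ξ : loopAlg D n G) :
    (Ad D G h ξ).1 = h.1 * ξ.1 * (h⁻¹).1 := rfl

theorem nonempty_Upunct (D : CoordDisk X) : (D.Upunct : Set X).Nonempty :=
  (isConnected_Upunct D).nonempty

variable {h : LGL D n} {f : X → ℂ} {g m : X → Matrix (Fin n) (Fin n) ℂ}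

theorem IsScalarTimesMeromorphic.m_eq (H : IsScalarTimesMeromorphic D T h f g m) {y : X}
    (hy : y ∈ D.Upunct) : m y = zeroExtMat (T⁻¹).1 y * g y * zeroExtMat T.1 y := by
  rw [zeroExtMat_of_mem _ hy, zeroExtMat_of_mem _ hy]
  exact H.conj_eq ⟨y, hy⟩

theorem zeroExtMat_inv (a : LGL D n) {y : X} (hy : y ∈ D.Upunct) :
    (zeroExtMat a.1 y)⁻¹ = zeroExtMat (a⁻¹).1 y :=
  Matrix.inv_eq_left_inv (zeroExtMat_inv_mul a hy)

theorem IsScalarTimesMeromorphic.m_inv_eq (H : IsScalarTimesMeromorphic D T h f g m) {y : X}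
    (hy : y ∈ D.Upunct) : (m y)⁻¹ = zeroExtMat (T⁻¹).1 y * (g y)⁻¹ * zeroExtMat T.1 y := by
  rw [H.m_eq hy, Matrix.mul_inv_rev, Matrix.mul_inv_rev, zeroExtMat_inv T hy,
    zeroExtMat_inv T⁻¹ hy, inv_inv, mul_assoc]

theorem IsScalarTimesMeromorphic.eventually_conj [NeZero n]
    (H : IsScalarTimesMeromorphic D T h f g m) {x : X} (hx : x ∈ D.Upunct)
    (A : X → Matrix (Fin n) (Fin n) ℂ) :
    ∀ᶠ y in 𝓝[≠] x, zeroExtMat h.1 y * A y * zeroExtMat (h⁻¹).1 y = g y * A y * (g y)⁻¹ := by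
  filter_upwards [H.eventually_ne_zero hx] with y hy
  obtain ⟨hy, hf, e⟩ := hy
  have hg : IsUnit (g y).det := by
    rw [isUnit_iff_ne_zero]
    intro h0
    apply det_zeroExtMat_ne_zero h hy
    rw [e, Matrix.det_smul, h0, mul_zero]
  have : zeroExtMat (h⁻¹).1 y = (f y)⁻¹ • (g y)⁻¹ := by
    rw [← zeroExtMat_inv h hy]
    refine Matrix.inv_eq_left_inv ?_
    rw [e, Matrix.smul_mul, Matrix.mul_smul, Matrix.nonsing_inv_mul _ hg, smul_smul,
      inv_mul_cancel₀ hf, one_smul]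
  rw [e, this]
  simp only [Matrix.smul_mul, Matrix.mul_smul, smul_smul, inv_mul_cancel₀ hf,
    one_smul]

variable [IsManifold 𝓘(ℂ) ω X]

theorem res_Up_injective [ConnectedSpace X] (D : CoordDisk X) :
    Function.Injective (resUp D) :=
  res_injective _ (isConnected_Up D).isPreconnected (nonempty_Upunct D)

theorem res_Um_injective (D : CoordDisk X) :
    Function.Injective (resUm D) :=
  res_injective _ (isConnected_Um D).isPreconnected (nonempty_Upunct D)

theorem IsScalarTimesMeromorphic.poleOrder_m (H : IsScalarTimesMeromorphic D T h f g m) {y : X}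
    (hy : y ∈ D.Upunct) (hg : MatMeroAt g y) :
    poleOrder m y = poleOrder g y ∧ poleOrder (fun x => (m x)⁻¹) y =
      poleOrder (fun x => (g x)⁻¹) y := by
  have hU : ∀ᶠ w in 𝓝[≠] y, w ∈ D.Upunct :=
    mem_nhdsWithin_of_mem_nhds (D.Upunct.isOpen.mem_nhds hy)
  rw [← poleOrder_mul_mul T⁻¹ T hy hg, ← poleOrder_mul_mul T⁻¹ T hy hg.inv]
  exact ⟨poleOrder_congr (hU.mono fun w hw => H.m_eq hw),
    poleOrder_congr (hU.mono fun w hw => H.m_inv_eq hw)⟩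

/-- Poles of `m` and `m⁻¹` cannot accumulate in `U₊`, where both are meromorphic, nor at the centre,
near which they are conjugate to `g` and `g⁻¹`. Compactness then leaves finitely many. -/
theorem IsScalarTimesMeromorphic.finite_bad [CompactSpace X]
    (H : IsScalarTimesMeromorphic D T h f g m) :
    {x | x ∈ D.Up ∧ 0 < poleOrder m x + poleOrder (fun y => (m y)⁻¹) x}.Finite := by
  refine finite_of_forall_eventually_notMem fun x => ?_
  by_cases hx : x = D.center
  · subst hx
    filter_upwards [H.mero_center.eventually_matHolAt, H.mero_center.inv.eventually_matHolAt,
      eventually_mem_Upunct D] with y h1 h2 hy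
    obtain ⟨e1, e2⟩ := H.poleOrder_m hy h1.matMeroAt
    simp [e1, e2, h1.poleOrder_eq_zero, h2.poleOrder_eq_zero]
  · filter_upwards [(H.mero x hx).eventually_matHolAt, (H.mero x hx).inv.eventually_matHolAt]
      with y h1 h2
    simp [h1.poleOrder_eq_zero, h2.poleOrder_eq_zero]

/-- For `a` vanishing to the combined pole orders of `m` and `m⁻¹`, the product `m a m⁻¹` extends to
a holomorphic `b`, and `Ad_h (T a T⁻¹) = T b T⁻¹` has no minus part. -/
theorem IsScalarTimesMeromorphic.finiteDimensional_plus [NeZero n] [CompactSpace X]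
    [ConnectedSpace X] (H : IsScalarTimesMeromorphic D T h f g m)
    (hsplit : IsCompl (loopPlus D G T) (loopMinus D n G k)) :
    FiniteDimensional ℂ ((loopPlus D G T).map (projMinus D hsplit ∘ₗ Ad D G h)) := by
  obtain ⟨S, hS, hSord⟩ := exists_submodule_le_ordAt (n := n) (U := D.Up) _ H.finite_bad
  refine finiteDimensional_map_comap _ S _ _ _ fun a ha haS ξ hξ => ?_
  refine Submodule.projection_apply_of_mem_right hsplit.symm ?_
  have hmero : ∀ x ∈ D.Up, MatMeroAt (fun y => m y * zeroExtMat a y) x := fun x hx =>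
    (H.mero x hx).mul (matHolAt_zeroExtMat a hx).matMeroAt
  obtain ⟨b, hb⟩ := exists_holMat_of_ordAt_nonneg (U := D.Up)
    (M := fun y => m y * zeroExtMat a y * (m y)⁻¹)
    (fun x hx => (hmero x hx).mul (H.mero x hx).inv) (fun x hx i j => by
      refine le_of_eq_of_le ?_ (le_ordAt_matMul (hmero x hx) (H.mero x hx).inv
        (le_ordAt_matMul (H.mero x hx) (matHolAt_zeroExtMat a hx).matMeroAt neg_poleOrder_le
          (hSord a haS x hx)) neg_poleOrder_le i j)
      rw [← WithTop.coe_add, ← WithTop.coe_add, ← WithTop.coe_zero]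
      congr 1
      push_cast
      ring)
  have hξ' : ξ.1 = T.1 * (resUp D).mapMatrix a * (T⁻¹).1 := hξ
  have key : T.1 * (resUp D).mapMatrix b * (T⁻¹).1 =
      (Ad D G h ξ).1 := by
    refine holMat_ext fun y hy => ?_
    rw [Ad_val, hξ']
    simp only [evalMat_mul, evalMat_map_resUp]
    simp only [← zeroExtMat_of_mem _ hy, ← zeroExtMat_of_mem _ (show y ∈ D.Up from hy.2)]
    have hT := matHolAt_zeroExtMat T.1 hy
    have hT' := matHolAt_zeroExtMat (T⁻¹).1 hy
    refine MatHolAt.eq_of_eventuallyEq (M := fun y => zeroExtMat T.1 y * zeroExtMat b y *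
      zeroExtMat (T⁻¹).1 y) (N := fun y => zeroExtMat h.1 y * (zeroExtMat T.1 y * zeroExtMat a y *
      zeroExtMat (T⁻¹).1 y) * zeroExtMat (h⁻¹).1 y)
      ((hT.mul (matHolAt_zeroExtMat b hy.2)).mul hT')
      (((matHolAt_zeroExtMat h.1 hy).mul ((hT.mul (matHolAt_zeroExtMat a hy.2)).mul hT')).mul
        (matHolAt_zeroExtMat (h⁻¹).1 hy)) ?_
    filter_upwards [hb y hy.2, H.eventually_conj hy (fun y => zeroExtMat T.1 y * zeroExtMat a y *
      zeroExtMat (T⁻¹).1 y), mem_nhdsWithin_of_mem_nhds (D.Upunct.isOpen.mem_nhds hy)]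
      with w h1 h2 hw
    rw [h2, ← h1, H.m_eq hw, ← H.m_eq hw, H.m_inv_eq hw, H.m_eq hw]
    have t1 := zeroExtMat_mul_inv T hw
    rw [show zeroExtMat T.1 w * (zeroExtMat (T⁻¹).1 w * g w * zeroExtMat T.1 w * zeroExtMat a w *
      (zeroExtMat (T⁻¹).1 w * (g w)⁻¹ * zeroExtMat T.1 w)) * zeroExtMat (T⁻¹).1 w =
      (zeroExtMat T.1 w * zeroExtMat (T⁻¹).1 w) * g w * (zeroExtMat T.1 w * zeroExtMat a w *
      zeroExtMat (T⁻¹).1 w) * (g w)⁻¹ * (zeroExtMat T.1 w * zeroExtMat (T⁻¹).1 w) by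
        noncomm_ring, t1, one_mul, mul_one]
  refine mem_loopPlus.2 ⟨b, ?_, key⟩
  refine lie_of_map_mem (res_Up_injective D) ?_
  have h1 := conjLin_mem D G T⁻¹ _ (Ad D G h ξ).2
  rw [← key, conjLin_apply, inv_inv] at h1
  have t1 : (T⁻¹).1 * T.1 = 1 := by rw [← Units.val_mul, inv_mul_cancel, Units.val_one]
  rwa [mul_assoc, mul_assoc _ (T⁻¹).1 T.1, t1, mul_one, ← mul_assoc, t1, one_mul] at h1

omit [T2Space X] in
theorem le_ordAt_coord_pow (N : ℕ) :
    ((N : ℤ) : WithTop ℤ) ≤ ordAt (fun y => zeroExt (coordFn D) y ^ N) D.center := by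
  have hz := holAt_zeroExt (coordFn D) (center_mem_Um D)
  have h1 : 1 ≤ ordAt (zeroExt (coordFn D)) D.center := hz.one_le_ordAt (by
    rw [zeroExt_of_mem _ (center_mem_Um D), coordFn_apply, coord_center])
  induction N with
  | zero => simpa using (hz.pow 0).ordAt_nonneg
  | succ N ih =>
    simp only [pow_succ]
    rw [ordAt_mul (hz.pow N).meroAt hz.meroAt]
    exact le_of_eq_of_le (by push_cast; rfl) (add_le_add ih h1)

theorem exists_submodule_coord_pow_dvd (D : CoordDisk X) (n M : ℕ) :
    ∃ S : Submodule ℂ (Matrix (Fin n) (Fin n) (Hol D.Um)), FiniteDimensional ℂ (_ ⧸ S) ∧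
      ∀ a ∈ S, ∀ i j, coordFn D ^ M ∣ a i j := by
  obtain ⟨L, hL⟩ := exists_linearMap_coordFn_pow_dvd D M
  let Λ : Matrix (Fin n) (Fin n) (Hol D.Um) →ₗ[ℂ] (Fin n → Fin n → Fin M → ℂ) :=
    LinearMap.pi fun i => LinearMap.pi fun j => L ∘ₗ Matrix.entryLinearMap ℂ (Hol D.Um) i j
  exact ⟨LinearMap.ker Λ, finiteDimensional_quotient_ker Λ, fun a ha i j =>
    hL _ (congrFun (congrFun ha i) j)⟩

theorem IsScalarTimesMeromorphic.finiteDimensional_minus [NeZero n]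
    (H : IsScalarTimesMeromorphic D T h f g m)
    (hsplit : IsCompl (loopPlus D G T) (loopMinus D n G k)) :
    FiniteDimensional ℂ ((loopMinus D n G k).map (projPlus D hsplit ∘ₗ Ad D G h)) := by
  let N : ℕ := poleOrder g D.center + poleOrder (fun y => (g y)⁻¹) D.center
  -- The factor `z ^ N` absorbs the poles of `g` and `g⁻¹`; the remaining `z ^ k` is the vanishing
  -- required of elements of `L𝔤₋`.
  obtain ⟨S, hS, hSdvd⟩ := exists_submodule_coord_pow_dvd D n (k + N)
  refine finiteDimensional_map_comap _ S _ _ _ fun a ha haS ξ hξ => ?_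
  refine Submodule.projection_apply_of_mem_right hsplit ?_
  choose c hc using hSdvd a haS
  have hac : a = coordFn D ^ (k + N) • Matrix.of c := by
    ext1 i j
    exact hc i j
  have hz : ∀ x ∈ D.Um, HolAt (zeroExt (coordFn D)) x := fun x hx => holAt_zeroExt _ hx
  let M : X → Matrix (Fin n) (Fin n) ℂ := fun y =>
    (g y * (zeroExt (coordFn D) y ^ N • zeroExtMat (Matrix.of c) y)) * (g y)⁻¹
  have hA : ∀ x ∈ D.Um, MatHolAt (fun y => zeroExt (coordFn D) y ^ N • zeroExtMat (Matrix.of c) y)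
      x := fun x hx i j => ((hz x hx).pow N).mul (matHolAt_zeroExtMat (Matrix.of c) hx i j)
  have hloc : ∀ x ∈ D.Upunct, (fun y => zeroExtMat h.1 y *
      (zeroExt (coordFn D) y ^ N • zeroExtMat (Matrix.of c) y) * zeroExtMat (h⁻¹).1 y)
        =ᶠ[𝓝[≠] x] M := fun x hx => H.eventually_conj hx _
  have hhol : ∀ x ∈ D.Upunct, MatHolAt (fun y => zeroExtMat h.1 y *
      (zeroExt (coordFn D) y ^ N • zeroExtMat (Matrix.of c) y) * zeroExtMat (h⁻¹).1 y) x :=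
    fun x hx => ((matHolAt_zeroExtMat h.1 hx).mul (hA x hx.1)).mul (matHolAt_zeroExtMat (h⁻¹).1 hx)
  have hcen := (hA _ (center_mem_Um D)).matMeroAt
  obtain ⟨b, hb⟩ := exists_holMat_of_ordAt_nonneg (U := D.Um) (M := M) (fun x hx => by
      by_cases hxc : x = D.center
      · subst hxc
        exact (H.mero_center.mul hcen).mul H.mero_center.inv
      · exact (hhol x ⟨hx, hxc⟩).matMeroAt.congr (hloc x ⟨hx, hxc⟩)) (fun x hx i j => by
      by_cases hxc : x = D.center
      · subst hxc
        refine le_of_eq_of_le ?_ (le_ordAt_matMul (H.mero_center.mul hcen) H.mero_center.inv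
          (le_ordAt_matMul (d := ((N : ℤ) : WithTop ℤ)) H.mero_center hcen neg_poleOrder_le
            fun i j => ?_) neg_poleOrder_le i j)
        · rw [← WithTop.coe_add, ← WithTop.coe_add, ← WithTop.coe_zero]
          congr 1
          simp only [N]
          push_cast
          ring
        · have h1 := matHolAt_zeroExtMat (Matrix.of c) hx i j
          simp only [Matrix.smul_apply, smul_eq_mul]
          rw [ordAt_mul ((hz _ hx).pow N).meroAt h1.meroAt]
          exact le_of_eq_of_le (add_zero _).symm
            (add_le_add (le_ordAt_coord_pow N) h1.ordAt_nonneg)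
      · rw [← ordAt_congr ((hloc x ⟨hx, hxc⟩).mono fun y hy =>
          congrFun (congrFun hy i) j)]
        exact (hhol x ⟨hx, hxc⟩).ordAt_nonneg i j)
  have hξ' : ξ.1 = (resUm D).mapMatrix a := hξ
  have key : (resUm D).mapMatrix (coordFn D ^ k • b) =
      (Ad D G h ξ).1 := by
    refine holMat_ext fun y hy => ?_
    rw [Ad_val, hξ', hac]
    simp only [evalMat_mul, evalMat_map_resUm]
    have hsm : ∀ (q : ℕ) (u : Matrix (Fin n) (Fin n) (Hol D.Um)),
        evalMat (coordFn D ^ q • u) ⟨y, hy.1⟩ =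
          zeroExt (coordFn D) y ^ q • zeroExtMat u y := by
      intro q u
      rw [zeroExt_of_mem _ hy.1, zeroExtMat_of_mem _ hy.1]
      rfl
    rw [hsm, hsm, pow_add, ← smul_smul, Matrix.mul_smul, Matrix.smul_mul]
    congr 1
    rw [← zeroExtMat_of_mem _ hy, ← zeroExtMat_of_mem _ hy]
    refine MatHolAt.eq_of_eventuallyEq (matHolAt_zeroExtMat b hy.1) (hhol y hy) ?_
    exact (hb y hy.1).symm.trans (hloc y hy).symm
  refine mem_loopMinus.2 ⟨_, ?_, fun i j => ?_, key⟩
  · refine lie_of_map_mem (res_Um_injective D) ?_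
    rw [key]
    exact (Ad D G h ξ).2
  · exact Dvd.intro _ rfl

theorem IsScalarTimesMeromorphic.hasFiniteDimLeaf [CompactSpace X] [ConnectedSpace X]
    (H : IsScalarTimesMeromorphic D T h f g m)
    (hsplit : IsCompl (loopPlus D G T) (loopMinus D n G k)) : HasFiniteDimLeaf D hsplit h := by
  unfold HasFiniteDimLeaf
  rcases Nat.eq_zero_or_pos n with rfl | hn
  · have : Subsingleton (dressingTangent D hsplit h) :=
      ⟨fun a b => Subtype.ext (Subtype.ext (Subsingleton.elim _ _))⟩
    infer_instance
  · have : NeZero n := ⟨hn.ne'⟩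
    have h1 := H.finiteDimensional_plus hsplit
    have h2 := H.finiteDimensional_minus hsplit
    exact Submodule.finite_sup _ _

end leaf

/-! ### Algebra behind necessity: common denominators and a dimension count. -/

section algebra

variable {n : ℕ} {G : StructureGroup} {R S : Type*} [CommRing R] [CommRing S]

theorem mul_single_mul_apply (g h : Matrix (Fin n) (Fin n) R) (i j k l : Fin n) (r : R) :
    (g * Matrix.single j k r * h) i l = r * g i j * h k l := by
  rw [Matrix.mul_assoc, Matrix.mul_apply, Finset.sum_eq_single j]
  · rw [Matrix.single_mul_apply_same]
    ring
  · intro b _ hb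
    rw [Matrix.single_mul_apply_of_ne _ _ _ _ _ hb, mul_zero]
  · simp

/-- Orthogonality to the traceless matrices makes `M` scalar; its trace is then `n` times the
diagonal entry, and `n ≠ 0` in characteristic zero. -/
theorem eq_zero_of_trace_eq_zero [IsDomain R] [CharZero R] {M : Matrix (Fin n) (Fin n) R}
    (h1 : M.trace = 0) (h2 : ∀ i j, i ≠ j → (Matrix.single i j 1 * M).trace = 0)
    (h3 : ∀ i j, ((Matrix.single i i 1 - Matrix.single j j 1) * M).trace = 0) : M = 0 := by
  have hdiag : ∀ i j, M i i = M j j := by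
    intro i j
    have := h3 i j
    rw [sub_mul, Matrix.trace_sub, Matrix.trace_single_mul, Matrix.trace_single_mul] at this
    simpa [sub_eq_zero] using this
  ext i j
  by_cases hij : i = j
  · subst hij
    have h4 : M.trace = n * M i i := by
      simp [Matrix.trace, hdiag _ i]
    have hn : (n : R) ≠ 0 := by
      rw [Nat.cast_ne_zero]
      rintro rfl
      exact i.elim0
    rw [h4] at h1
    simpa [hn] using h1
  · have := h2 j i (Ne.symm hij)
    rw [Matrix.trace_single_mul] at this
    simpa using this

theorem exists_entry_ne_zero [Nontrivial R] (hn : 0 < n) (h : GL (Fin n) R) :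
    ∃ i j, h.1 i j ≠ 0 := by
  by_contra! hcon
  have : NeZero n := ⟨hn.ne'⟩
  have h0 : h.1 = 0 := by
    ext i j
    exact hcon i j
  exact h.ne_zero h0

variable [Algebra ℂ R] [Algebra ℂ S]

theorem smul_mem_lie (r : R) {M : Matrix (Fin n) (Fin n) R} (hM : M ∈ G.lie n R) :
    r • M ∈ G.lie n R := by
  cases G with
  | gl => trivial
  | sl =>
    have h1 : Matrix.trace M = 0 := hM
    change Matrix.trace (r • M) = 0
    rw [Matrix.trace_smul, h1, smul_zero]

theorem single_mem_lie {j k : Fin n} (hjk : j ≠ k) (r : R) : Matrix.single j k r ∈ G.lie n R := by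
  cases G with
  | gl => trivial
  | sl => exact Matrix.trace_single_eq_of_ne j k r hjk

theorem single_sub_single_mem_lie (j k : Fin n) (r : R) :
    Matrix.single j j r - Matrix.single k k r ∈ G.lie n R := by
  cases G with
  | gl => trivial
  | sl =>
    change Matrix.trace (Matrix.single j j r - Matrix.single k k r) = 0
    rw [Matrix.trace_sub, Matrix.trace_single_eq_same, Matrix.trace_single_eq_same, sub_self]

/-- The root vectors of `𝔤`, with coefficients in `R`. -/
def offDiag (G : StructureGroup) {j k : Fin n} (hjk : j ≠ k) : R →ₗ[ℂ] G.lie n R :=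
  (Matrix.singleLinearMap ℂ j k).codRestrict _ fun r => single_mem_lie hjk r

theorem offDiag_val {j k : Fin n} (hjk : j ≠ k) (r : R) :
    (offDiag G hjk r).1 = Matrix.single j k r := rfl

/-- If conjugation by `h` maps multiples of root vectors into a subring up to a space of finite
dimension, then all products of entries of `h` and `h⁻¹` have a common denominator. -/
theorem exists_common_denominator [IsDomain S] (hS : ¬ FiniteDimensional ℂ S) (hn : 2 ≤ n)
    (ρ : S →ₐ[ℂ] R) (h : GL (Fin n) R) {V : Type*} [AddCommGroup V] [Module ℂ V]
    (F : Submodule ℂ V) [FiniteDimensional ℂ F]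
    (Ψ : ∀ j k : Fin n, j ≠ k → S →ₗ[ℂ] V) (hF : ∀ j k hjk q, Ψ j k hjk q ∈ F) {s : S} (hs : s ≠ 0)
    (hΨ : ∀ j k hjk q, Ψ j k hjk q = 0 → ∃ B : Matrix (Fin n) (Fin n) S, ∀ i l,
      ρ (s * q) * h.1 i j * (h⁻¹).1 k l = ρ (B i l)) :
    ∃ q : S, q ≠ 0 ∧ ∃ B : Fin n → Fin n → Matrix (Fin n) (Fin n) S, ∀ i j k l,
      ρ q * h.1 i j * (h⁻¹).1 k l = ρ (B k l i j) := by
  -- All the maps `Ψ j k` are bundled so that one nonzero `q` lies in every kernel.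
  let Θ : S →ₗ[ℂ] ({p : Fin n × Fin n // p.1 ≠ p.2} → F) :=
    LinearMap.pi fun p => (Ψ p.1.1 p.1.2 p.2).codRestrict F (hF _ _ _)
  have hnot : ¬ Function.Injective Θ := fun hinj => hS (FiniteDimensional.of_injective Θ hinj)
  rw [injective_iff_map_eq_zero] at hnot
  push Not at hnot
  obtain ⟨q, hq0, hq⟩ := hnot
  have hoff : ∀ j k (hjk : j ≠ k), ∃ B : Matrix (Fin n) (Fin n) S, ∀ i l,
      ρ (s * q) * h.1 i j * (h⁻¹).1 k l = ρ (B i l) := fun j k hjk =>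
    hΨ j k hjk q (congrArg Subtype.val (congrFun hq0 ⟨(j, k), hjk⟩))
  choose B hB using hoff
  have hex : ∀ k l i j, ∃ A : S, ρ ((s * q) ^ 2) * h.1 i j * (h⁻¹).1 k l = ρ A := by
    intro k l i j
    by_cases hjk : j = k
    · subst hjk
      have : Nontrivial (Fin n) := Fin.nontrivial_iff_two_le.2 hn
      obtain ⟨r, hr⟩ := exists_ne j
      -- Diagonal matrices are not root vectors, so `1 = ∑ t, (h⁻¹)_rt h_tr` with `r ≠ j` is
      -- inserted, giving sums of products of two off-diagonal terms. This is why the denominator is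
      -- the square of `s * q`.
      refine ⟨∑ t, B j r hr.symm i t * B r j hr t l, ?_⟩
      rw [map_sum]
      simp only [map_mul, ← hB]
      have h1 : ∑ t, (h⁻¹).1 r t * h.1 t r = 1 := by
        rw [← Matrix.mul_apply, ← Units.val_mul, inv_mul_cancel, Units.val_one,
          Matrix.one_apply_eq]
      calc ρ ((s * q) ^ 2) * h.1 i j * (h⁻¹).1 j l
          = ∑ t, ρ (s * q) * h.1 i j * (ρ (s * q) * (h⁻¹).1 j l) * ((h⁻¹).1 r t * h.1 t r) := by
            rw [← Finset.mul_sum, h1, map_pow]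
            ring
        _ = _ := Finset.sum_congr rfl fun t _ => by rw [map_mul]; ring
    · refine ⟨s * q * B j k hjk i l, ?_⟩
      rw [map_mul ρ (s * q), ← hB, map_pow]
      ring
  choose A hA using hex
  exact ⟨(s * q) ^ 2, pow_ne_zero _ (mul_ne_zero hs hq), fun k l => Matrix.of (A k l),
    fun i j k l => hA k l i j⟩

/-- Multiplication by the unit `z` is surjective on the finite-dimensional quotient `R ⧸ K`, hence
injective. -/
theorem mem_of_mul_mem_of_finiteDimensional {K : Submodule ℂ R} [FiniteDimensional ℂ (R ⧸ K)]
    {z w : R} (hzw : z * w = 1) (hz : ∀ φ ∈ K, z * φ ∈ K) {φ : R} (hφ : z * φ ∈ K) : φ ∈ K := by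
  have hsurj : Function.Surjective (K.mapQ K (LinearMap.mulLeft ℂ z) hz) := by
    intro x
    obtain ⟨φ, rfl⟩ := Submodule.mkQ_surjective _ x
    refine ⟨K.mkQ (w * φ), ?_⟩
    change K.mkQ (z * (w * φ)) = _
    rw [← mul_assoc, hzw, one_mul]
  rw [← Submodule.Quotient.mk_eq_zero]
  apply LinearMap.injective_iff_surjective.2 hsurj
  rw [map_zero]
  exact (Submodule.Quotient.mk_eq_zero _).2 hφ

/-- If the multiples of `t ^ k` in a subring have finite codimension, then the inverse of `t` lies
in the subring. -/
theorem exists_eq_inv_of_finiteDimensional {V : Type*} [AddCommGroup V] [Module ℂ V]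
    [FiniteDimensional ℂ V] (ψ : R →ₗ[ℂ] V) (ρ : S →ₐ[ℂ] R) {t : S} {k : ℕ}
    (hker : ∀ φ, ψ φ = 0 ↔ ∃ q, t ^ k ∣ q ∧ ρ q = φ) {w : R} (hw : ρ t * w = 1) :
    ∃ q, ρ q = w := by
  have := finiteDimensional_quotient_ker ψ
  have hdiv : ∀ φ, ρ t * φ ∈ LinearMap.ker ψ → φ ∈ LinearMap.ker ψ := by
    refine fun φ hφ => mem_of_mul_mem_of_finiteDimensional hw (fun φ hφ => ?_) hφ
    obtain ⟨q, hq, rfl⟩ := (hker φ).1 hφ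
    exact (hker _).2 ⟨t * q, hq.mul_left _, map_mul _ _ _⟩
  have hpow : ∀ j φ, ρ t ^ j * φ ∈ LinearMap.ker ψ → φ ∈ LinearMap.ker ψ := by
    intro j
    induction j with
    | zero => intro φ hφ; simpa using hφ
    | succ j ih =>
      intro φ hφ
      exact ih _ (hdiv _ (by rwa [pow_succ', mul_assoc] at hφ))
  have hwk : w ∈ LinearMap.ker ψ := by
    -- The product `t ^ (k + 1) * w` equals `t ^ k`, which lies in the kernel; the powers of `t` are
    -- then cancelled.
    refine hpow (k + 1) w ?_
    rw [pow_succ, mul_assoc, hw, mul_one]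
    exact (hker _).2 ⟨t ^ k, dvd_rfl, map_pow _ _ _⟩
  obtain ⟨q, -, hq⟩ := (hker w).1 hwk
  exact ⟨q, hq⟩

end algebra

/-! ### Root vectors with function coefficients in the two halves of the loop algebra. -/

section loops

variable {X : Type*} [TopologicalSpace X] [T2Space X] [ChartedSpace ℂ X]
  {D : CoordDisk X} {n : ℕ} {G : StructureGroup} {k : ℕ} {T : LGL D n}

theorem offDiag_mem_loopMinus {i j : Fin n} (hij : i ≠ j) {q : Hol D.Um}
    (hq : coordFn D ^ k ∣ q) :
    (offDiag G hij (resUm D q) : loopAlg D n G) ∈ loopMinus D n G k := by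
  refine mem_loopMinus.2 ⟨Matrix.single i j q, single_mem_lie hij q, fun a b => ?_, ?_⟩
  · rw [Matrix.single_apply]
    split_ifs
    · exact hq
    · exact dvd_zero _
  · rw [offDiag_val, AlgHom.mapMatrix_apply, Matrix.map_single]

theorem Ad_offDiag_mem_loopPlus {i j : Fin n} (hij : i ≠ j) (q : Hol D.Up) :
    Ad D G T (offDiag G hij (resUp D q)) ∈ loopPlus D G T := by
  refine mem_loopPlus.2 ⟨Matrix.single i j q, single_mem_lie hij q, ?_⟩
  rw [Ad_val, offDiag_val, AlgHom.mapMatrix_apply, Matrix.map_single]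

/-- Conjugation by `T⁻¹` embeds `L𝔤₊` into the matrices over the functions on `U₊`. -/
theorem finiteDimensional_loopPlus (D : CoordDisk X) (n : ℕ) (G : StructureGroup) (T : LGL D n)
    (hfin : FiniteDimensional ℂ (Hol D.Up)) : FiniteDimensional ℂ (loopPlus D G T) := by
  have hmat : FiniteDimensional ℂ (Matrix (Fin n) (Fin n) (Hol D.Up)) := Module.Finite.matrix
  have h2 : FiniteDimensional ℂ (Matrix (Fin n) (Fin n) (Hol D.Up) ⧸
      (⊥ : Submodule ℂ (Matrix (Fin n) (Fin n) (Hol D.Up)))) := inferInstance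
  have h3 := finiteDimensional_map_comap (G.lie n (Hol D.Up)) ⊥
    (conjLin D T ∘ₗ (resUp D).mapMatrix.toLinearMap) (loopAlg D n G) LinearMap.id
    (fun a _ ha ξ hξ => by
      rw [(Submodule.mem_bot ℂ).1 ha, map_zero] at hξ
      exact Subtype.ext hξ)
  rwa [Submodule.map_id] at h3

end loops

/-! ### Infinite-dimensionality of the spaces of holomorphic functions. -/

section disk

variable {X : Type*} [TopologicalSpace X] [T2Space X] [ChartedSpace ℂ X]
  [IsManifold 𝓘(ℂ) ω X] (D : CoordDisk X)

/-- Multiplication by `z` is injective but never attains `1`, which does not vanish at the centre.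
-/
theorem not_finiteDimensional_hol_Um : ¬ FiniteDimensional ℂ (Hol D.Um) := by
  intro hfin
  have := hol_isDomain (isConnected_Um D)
  have hinj : Function.Injective (LinearMap.mulLeft ℂ (coordFn D)) := fun a b h =>
    mul_left_cancel₀ (coordFn_ne_zero D) h
  obtain ⟨F, hF⟩ := LinearMap.surjective_of_injective hinj 1
  have h1 := congrArg (evalHom ⟨D.center, center_mem_Um D⟩) hF
  rw [LinearMap.mulLeft_apply, map_mul, map_one, evalHom_apply, coordFn_apply, coord_center,
    zero_mul] at h1
  exact zero_ne_one h1

theorem eq_zero_of_forall_coord_pow_dvd {F : Hol D.Um} (h : ∀ j, coordFn D ^ j ∣ F) : F = 0 := by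
  by_contra hF
  have hc := center_mem_Um D
  have h1 : ∀ j : ℕ, ((j : ℤ) : WithTop ℤ) ≤ ordAt (zeroExt F) D.center := by
    intro j
    obtain ⟨K, hK⟩ := h j
    have e : zeroExt F =ᶠ[𝓝[≠] D.center]
        fun y => zeroExt (coordFn D) y ^ j * zeroExt K y := by
      filter_upwards [eventually_mem_Upunct D] with y hy
      rw [zeroExt_of_mem _ hy.1, zeroExt_of_mem _ hy.1, zeroExt_of_mem _ hy.1, hK]
      rfl
    rw [ordAt_congr e, ordAt_mul ((holAt_zeroExt _ hc).pow j).meroAt (holAt_zeroExt K hc).meroAt]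
    exact le_of_eq_of_le (add_zero _).symm
      (add_le_add (le_ordAt_coord_pow j) (holAt_zeroExt K hc).ordAt_nonneg)
  have h2 : ordAt (zeroExt F) D.center = ⊤ := by
    generalize ordAt (zeroExt F) D.center = o at h1
    induction o with
    | top => rfl
    | coe a =>
      have := h1 (a.toNat + 1)
      rw [WithTop.coe_le_coe] at this
      omega
  have h3 := meromorphicOrderAt_eq_top_iff.1 h2
  have h4 := (eventually_nhdsNE_chart (chartAt ℂ D.center) (mem_chart_source ℂ D.center)
    (P := fun y => zeroExt F y = 0)).2 h3
  have := nhdsNE_neBot_of_chartedSpace D.center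
  obtain ⟨y, hy, hy'⟩ := (h4.and
    (eventually_zeroExt_ne_zero (isConnected_Um D).isPreconnected hF hc)).exists
  exact hy' hy

theorem exists_coord_inv : ∃ w : Hol D.Upunct, resUm D (coordFn D) * w = 1 := by
  have hne : ∀ y ∈ D.Upunct, D.coord y ≠ 0 := fun y hy h =>
    hy.2 ((coord_eq_zero_iff D hy.1).1 h)
  refine ⟨holMk (fun y => (D.coord y)⁻¹) fun y hy => (holAt_coord D hy.1).inv (hne y hy),
    hol_ext fun y => ?_⟩
  exact mul_inv_cancel₀ (hne y y.2)

variable {D} {n : ℕ} {G : StructureGroup} {k : ℕ} {T : LGL D n}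

/-- If `Hol D.Up` were finite-dimensional, so would be `L𝔤₊`, a complement of `L𝔤₋`. Looking at one
root vector, the multiples of `z ^ k` on `U₋` would have finite codimension among functions on the
punctured disk, forcing `1 / z` to extend over the centre. A root vector needs `n ≥ 2`. -/
theorem not_finiteDimensional_hol_Up (hn : 2 ≤ n)
    (hsplit : IsCompl (loopPlus D G T) (loopMinus D n G k)) :
    ¬ FiniteDimensional ℂ (Hol D.Up) := by
  intro hfin
  have hL := finiteDimensional_loopPlus D n G T hfin
  let i0 : Fin n := ⟨0, by omega⟩
  let i1 : Fin n := ⟨1, by omega⟩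
  have h01 : i0 ≠ i1 := by simp [i0, i1, Fin.ext_iff]
  let ψ : Hol D.Upunct →ₗ[ℂ] loopPlus D G T :=
    (projPlus D hsplit ∘ₗ offDiag G h01).codRestrict _ fun φ =>
      Submodule.projection_apply_mem hsplit _
  have hker : ∀ φ, ψ φ = 0 ↔ ∃ q, coordFn D ^ k ∣ q ∧ resUm D q = φ := by
    intro φ
    constructor
    · intro hφ
      have h1 : projPlus D hsplit (offDiag G h01 φ) = 0 := congrArg Subtype.val hφ
      obtain ⟨a, -, ha, hr⟩ := mem_loopMinus.1 ((Submodule.projection_apply_eq_zero_iff hsplit).1 h1)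
      refine ⟨a i0 i1, ha _ _, ?_⟩
      have := congrFun (congrFun hr i0) i1
      rwa [offDiag_val, Matrix.single_apply_same] at this
    · rintro ⟨q, hq, rfl⟩
      exact Subtype.ext (Submodule.projection_apply_of_mem_right hsplit
        (offDiag_mem_loopMinus h01 hq))
  obtain ⟨w, hw⟩ := exists_coord_inv D
  obtain ⟨q, rfl⟩ := exists_eq_inv_of_finiteDimensional (V := loopPlus D G T) ψ
    (resUm D) (k := k) hker hw
  rw [← map_mul, ← map_one (resUm D)] at hw
  have h1 := congrArg (evalHom ⟨D.center, center_mem_Um D⟩) (res_Um_injective D hw)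
  rw [map_mul, map_one, evalHom_apply, coordFn_apply, coord_center, zero_mul] at h1
  exact zero_ne_one h1

end disk

/-! ### Necessity in (a): a single scalar for both sides. -/

section denominators

variable {X : Type*} [TopologicalSpace X] [T2Space X] [ChartedSpace ℂ X]
  [IsManifold 𝓘(ℂ) ω X] {D : CoordDisk X} {n : ℕ} {G : StructureGroup} {k : ℕ} {T h : LGL D n}

/-- Products of entries of `h` and `h⁻¹` are meromorphic at the centre. -/
theorem exists_common_denominator_Um (hn : 2 ≤ n)
    (hsplit : IsCompl (loopPlus D G T) (loopMinus D n G k)) (hfin : HasFiniteDimLeaf D hsplit h) :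
    ∃ q : Hol D.Um, q ≠ 0 ∧ ∃ B : Fin n → Fin n → Matrix (Fin n) (Fin n) (Hol D.Um), ∀ i j k l,
      resUm D q * h.1 i j * (h⁻¹).1 k l = resUm D (B k l i j) := by
  have := hol_isDomain (isConnected_Um D)
  have : FiniteDimensional ℂ (dressingTangent D hsplit h) := hfin
  refine exists_common_denominator (not_finiteDimensional_hol_Um D) hn (resUm D) h
    (dressingTangent D hsplit h)
    (fun i j hij => projPlus D hsplit ∘ₗ Ad D G h ∘ₗ offDiag G hij ∘ₗ (resUm D).toLinearMap ∘ₗ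
      LinearMap.mulLeft ℂ (coordFn D ^ k))
    (fun i j hij q => Submodule.mem_sup_right
      ⟨_, offDiag_mem_loopMinus hij (Dvd.intro q rfl), rfl⟩)
    (pow_ne_zero k (coordFn_ne_zero D)) fun i j hij q hq => ?_
  obtain ⟨a, -, -, ha⟩ := mem_loopMinus.1 ((Submodule.projection_apply_eq_zero_iff hsplit).1 hq)
  refine ⟨a, fun r s => ?_⟩
  have h1 : resUm D (a r s) = (h.1 * Matrix.single i j (resUm D (coordFn D ^ k * q)) *
    (h⁻¹).1) r s := congrFun (congrFun ha r) s
  exact (mul_single_mul_apply h.1 (h⁻¹).1 r i j s _).symm.trans h1.symm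

/-- Products of entries of `T⁻¹ h T` and its inverse are meromorphic away from the centre. -/
theorem exists_common_denominator_Up [ConnectedSpace X] (hn : 2 ≤ n)
    (hsplit : IsCompl (loopPlus D G T) (loopMinus D n G k)) (hfin : HasFiniteDimLeaf D hsplit h) :
    ∃ q : Hol D.Up, q ≠ 0 ∧ ∃ B : Fin n → Fin n → Matrix (Fin n) (Fin n) (Hol D.Up), ∀ i j k l,
      resUp D q * (T⁻¹ * h * T).1 i j * ((T⁻¹ * h * T)⁻¹).1 k l = resUp D (B k l i j) := by
  have := hol_isDomain (isConnected_Up D)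
  have : FiniteDimensional ℂ (dressingTangent D hsplit h) := hfin
  refine exists_common_denominator (not_finiteDimensional_hol_Up hn hsplit) hn (resUp D) _
    (dressingTangent D hsplit h)
    (fun i j hij => projMinus D hsplit ∘ₗ Ad D G h ∘ₗ Ad D G T ∘ₗ offDiag G hij ∘ₗ
      (resUp D).toLinearMap)
    (fun i j hij q => Submodule.mem_sup_left ⟨_, Ad_offDiag_mem_loopPlus hij q, rfl⟩)
    one_ne_zero fun i j hij q hq => ?_
  obtain ⟨a, -, ha⟩ := mem_loopPlus.1
    ((Submodule.projection_apply_eq_zero_iff hsplit.symm).1 hq)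
  refine ⟨a, fun r s => ?_⟩
  have ha' : T.1 * (resUp D).mapMatrix a * (T⁻¹).1 =
    h.1 * (T.1 * Matrix.single i j (resUp D q) * (T⁻¹).1) * (h⁻¹).1 := ha.trans rfl
  rw [one_mul]
  refine (mul_single_mul_apply (T⁻¹ * h * T).1 ((T⁻¹ * h * T)⁻¹).1 r i j s _).symm.trans ?_
  have h1 : (T⁻¹ * h * T).1 * Matrix.single i j (resUp D q) * ((T⁻¹ * h * T)⁻¹).1 =
      (resUp D).mapMatrix a := by
    have t1 : (T⁻¹).1 * T.1 = 1 := by rw [← Units.val_mul, inv_mul_cancel, Units.val_one]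
    rw [show (T⁻¹ * h * T)⁻¹ = T⁻¹ * h⁻¹ * T by group]
    simp only [Units.val_mul]
    calc _ = (T⁻¹).1 * (h.1 * (T.1 * Matrix.single i j (resUp D q) * (T⁻¹).1) * (h⁻¹).1) * T.1 := by
          noncomm_ring
      _ = (T⁻¹).1 * (T.1 * (resUp D).mapMatrix a * (T⁻¹).1) * T.1 := by rw [ha']
      _ = ((T⁻¹).1 * T.1) * (resUp D).mapMatrix a * ((T⁻¹).1 * T.1) := by noncomm_ring
      _ = _ := by rw [t1, one_mul, mul_one]
  exact congrFun (congrFun h1 r) s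

/-- A matrix of functions on the punctured disk that is meromorphic at the centre and of the form
`T y T⁻¹` with `y` holomorphic away from the centre. -/
def IsGlobalMeromorphic (T : LGL D n) (x : Matrix (Fin n) (Fin n) (Hol D.Upunct)) : Prop :=
  (∃ y : Matrix (Fin n) (Fin n) (Hol D.Up), x = T.1 * (resUp D).mapMatrix y * (T⁻¹).1) ∧
    ∃ (j : ℕ) (x₀ : Matrix (Fin n) (Fin n) (Hol D.Um)),
      resUm D (coordFn D) ^ j • x = (resUm D).mapMatrix x₀

theorem trace_map {R S : Type*} [CommRing R] [CommRing S] [Algebra ℂ R] [Algebra ℂ S]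
    (φ : R →ₐ[ℂ] S) (M : Matrix (Fin n) (Fin n) R) :
    (φ.mapMatrix M).trace = φ M.trace := (AddMonoidHom.map_trace φ M).symm

/-- If pairing with all global meromorphic sections vanishes, then so does pairing with all
principal parts. -/
theorem trace_mul_eq_zero_of_forall (hsplit : IsCompl (loopPlus D G T) (loopMinus D n G k))
    (hx : ∀ x, IsGlobalMeromorphic T x → (x * h.1).trace = 0) {c : Hol D.Upunct} (hc : c ≠ 0)
    {A : Matrix (Fin n) (Fin n) (Hol D.Um)} (hA : c • h.1 = (resUm D).mapMatrix A)
    {E : Matrix (Fin n) (Fin n) (Hol D.Um)} (hE : (resUm D).mapMatrix E ∈ loopAlg D n G) :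
    ((resUm D).mapMatrix E * h.1).trace = 0 := by
  have := hol_isDomain (isConnected_Upunct D)
  obtain ⟨w, hw⟩ := exists_coord_inv D
  have key : (E * A).trace = 0 := by
    refine eq_zero_of_forall_coord_pow_dvd D fun j => ?_
    -- Here `w = 1 / z`. The plus part of `z ^ (-j) E` is global meromorphic and pairs to zero with
    -- `h`, so only the holomorphic minus part `a` contributes: `tr (E A) = z ^ j tr (a A)` for
    -- every `j`.
    let ξ : loopAlg D n G := ⟨w ^ j • (resUm D).mapMatrix E, smul_mem_lie _ hE⟩
    have hsum : projPlus D hsplit ξ + projMinus D hsplit ξ = ξ :=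
      Submodule.projection_add_projection_eq_self hsplit ξ
    obtain ⟨y, -, hy⟩ := mem_loopPlus.1 (Submodule.projection_apply_mem hsplit ξ)
    obtain ⟨a, -, -, ha⟩ := mem_loopMinus.1 (Submodule.projection_apply_mem hsplit.symm ξ)
    have hwj : resUm D (coordFn D) ^ j * w ^ j = 1 := by rw [← mul_pow, hw, one_pow]
    have hsum' : (projPlus D hsplit ξ).1 = w ^ j • (resUm D).mapMatrix E -
        (resUm D).mapMatrix a := by
      rw [ha]
      exact eq_sub_of_add_eq (congrArg Subtype.val hsum)
    have h1 := hx (projPlus D hsplit ξ).1 ⟨⟨y, hy.symm⟩, j, E - coordFn D ^ j • a, by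
      rw [hsum', smul_sub, smul_smul, hwj, one_smul, map_sub]
      congr 1⟩
    refine ⟨(a * A).trace, res_Um_injective D ?_⟩
    rw [map_mul, ← trace_map, ← trace_map, map_mul, map_mul, ← hA, map_pow]
    rw [hsum', sub_mul, Matrix.trace_sub, sub_eq_zero, Matrix.smul_mul, Matrix.trace_smul] at h1
    simp only [Matrix.mul_smul, Matrix.trace_smul, ← h1, smul_eq_mul]
    linear_combination (-(c * ((resUm D).mapMatrix E * h.1).trace)) * hwj
  have h2 := congrArg (resUm D) key
  rw [← trace_map, map_mul, ← hA, Matrix.mul_smul, Matrix.trace_smul, map_zero, smul_eq_mul] at h2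
  exact (mul_eq_zero.1 h2).resolve_left hc

/-- Otherwise `h` is orthogonal to all constant elements of `𝔤`. When `𝔤` is traceless this leaves
the scalar direction, which is handled by the global section `x = 1`. -/
theorem exists_isGlobalMeromorphic_trace_ne_zero (hn : 0 < n)
    (hsplit : IsCompl (loopPlus D G T) (loopMinus D n G k)) {c : Hol D.Upunct} (hc : c ≠ 0)
    {A : Matrix (Fin n) (Fin n) (Hol D.Um)} (hA : c • h.1 = (resUm D).mapMatrix A) :
    ∃ x, IsGlobalMeromorphic T x ∧ (x * h.1).trace ≠ 0 := by
  have := hol_isDomain (isConnected_Upunct D)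
  have : CharZero (Hol D.Upunct) := charZero_of_injective_algebraMap (algebraMap ℂ (Hol D.Upunct)).injective
  by_contra! hx
  have h1 : IsGlobalMeromorphic T (1 : Matrix (Fin n) (Fin n) (Hol D.Upunct)) := by
    refine ⟨⟨1, ?_⟩, 0, 1, ?_⟩
    · rw [map_one, mul_one, ← Units.val_mul, mul_inv_cancel, Units.val_one]
    · rw [map_one, pow_zero, one_smul]
  have htr := hx 1 h1
  rw [one_mul] at htr
  have hE : ∀ E : Matrix (Fin n) (Fin n) (Hol D.Um), (resUm D).mapMatrix E ∈ loopAlg D n G →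
      ((resUm D).mapMatrix E * h.1).trace = 0 := fun E hE =>
    trace_mul_eq_zero_of_forall hsplit hx hc hA hE
  have hs : ∀ i j, (resUm D).mapMatrix (Matrix.single i j 1 : Matrix (Fin n) (Fin n) (Hol D.Um)) =
      Matrix.single i j 1 := fun i j => by
    rw [AlgHom.mapMatrix_apply, Matrix.map_single, map_one]
  have h0 : h.1 = 0 := by
    refine eq_zero_of_trace_eq_zero htr (fun i j hij => ?_) fun i j => ?_
    · rw [← hs]
      exact hE _ (by rw [hs]; exact single_mem_lie hij 1)
    · rw [← hs, ← hs, ← map_sub]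
      exact hE _ (by rw [map_sub, hs, hs]; exact single_sub_single_mem_lie i j 1)
  obtain ⟨i, j, hij⟩ := exists_entry_ne_zero hn h
  exact hij (by rw [h0]; rfl)

/-- A finite-dimensional leaf: after division by a scalar, `h` is meromorphic at the centre and
`T⁻¹ h T` is meromorphic away from the centre. -/
theorem exists_scalar_of_hasFiniteDimLeaf [ConnectedSpace X] (hn : 0 < n)
    (hsplit : IsCompl (loopPlus D G T) (loopMinus D n G k)) (hfin : HasFiniteDimLeaf D hsplit h) :
    ∃ f : Hol D.Upunct, f ≠ 0 ∧
      (∃ (r : Hol D.Um) (A : Matrix (Fin n) (Fin n) (Hol D.Um)), r ≠ 0 ∧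
        resUm D r • h.1 = f • (resUm D).mapMatrix A) ∧
      ∃ (r : Hol D.Up) (A : Matrix (Fin n) (Fin n) (Hol D.Up)), r ≠ 0 ∧
        resUp D r • (T⁻¹ * h * T).1 = f • (resUp D).mapMatrix A := by
  have := hol_isDomain (isConnected_Upunct D)
  have := hol_isDomain (isConnected_Um D)
  have := hol_isDomain (isConnected_Up D)
  rcases Nat.lt_or_ge n 2 with h2 | h2
  -- For `n = 1` there are no root vectors, but `h` is itself a scalar and serves as `f`.
  · obtain rfl : n = 1 := by omega
    obtain ⟨i, j, hij⟩ := exists_entry_ne_zero hn h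
    obtain rfl : i = 0 := Subsingleton.elim _ _
    obtain rfl : j = 0 := Subsingleton.elim _ _
    refine ⟨h.1 0 0, hij, ⟨1, 1, one_ne_zero, ?_⟩, 1, 1, one_ne_zero, ?_⟩
    · ext1 i j
      rw [map_one, one_smul, map_one, Subsingleton.elim i 0, Subsingleton.elim j 0]
      simp
    · have hcomm : T⁻¹ * h * T = h := by
        apply Units.ext
        have e : (T⁻¹).1 * T.1 = 1 := by rw [← Units.val_mul, inv_mul_cancel, Units.val_one]
        have e' := congrFun (congrFun e 0) 0
        ext1 i j
        rw [Subsingleton.elim i 0, Subsingleton.elim j 0]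
        simp only [Units.val_mul, Matrix.mul_apply, Finset.univ_unique, Fin.default_eq_zero,
          Finset.sum_singleton, Matrix.one_apply_eq] at e' ⊢
        linear_combination h.1 0 0 * e'
      rw [hcomm]
      ext1 i j
      rw [map_one, one_smul, map_one, Subsingleton.elim i 0, Subsingleton.elim j 0]
      simp
  · obtain ⟨q, hq, B, hB⟩ := exists_common_denominator_Um h2 hsplit hfin
    obtain ⟨q', hq', B', hB'⟩ := exists_common_denominator_Up h2 hsplit hfin
    obtain ⟨s, t, hst⟩ := exists_entry_ne_zero hn h⁻¹
    obtain ⟨s', t', hst'⟩ := exists_entry_ne_zero hn (T⁻¹ * h * T)⁻¹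
    have hres : resUm D q ≠ 0 := fun h0 => hq (res_Um_injective D (h0.trans (map_zero _).symm))
    have hres' : resUp D q' ≠ 0 := fun h0 => hq' (res_Up_injective D (h0.trans (map_zero _).symm))
    have hA : (resUm D q * (h⁻¹).1 s t) • h.1 = (resUm D).mapMatrix (B s t) := by
      ext1 i j
      exact (by rw [Matrix.smul_apply, smul_eq_mul]; ring : _ = _).trans (hB i j s t)
    have hA' : (resUp D q' * ((T⁻¹ * h * T)⁻¹).1 s' t') • (T⁻¹ * h * T).1 =
        (resUp D).mapMatrix (B' s' t') := by
      ext1 i j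
      exact (by rw [Matrix.smul_apply, smul_eq_mul]; ring : _ = _).trans (hB' i j s' t')
    obtain ⟨x, ⟨⟨y, hy⟩, j, x₀, hx₀⟩, hx⟩ :=
      exists_isGlobalMeromorphic_trace_ne_zero hn hsplit (mul_ne_zero hres hst) hA
    set c := resUm D q * (h⁻¹).1 s t with hc
    set c' := resUp D q' * ((T⁻¹ * h * T)⁻¹).1 s' t' with hc'
    -- `c` and `c'` are the local scalars. `e1` and `e2` say that `tr (x h)` times `z ^ j c`,
    -- respectively `c'`, extends to `U₋`, respectively `U₊`; these extensions are the denominators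
    -- `r` sought.
    have e1 : resUm D (x₀ * B s t).trace = resUm D (coordFn D) ^ j * c * (x * h.1).trace := by
      rw [← trace_map, map_mul, ← hx₀, ← hA, Matrix.smul_mul, Matrix.mul_smul, Matrix.trace_smul,
        Matrix.trace_smul, smul_eq_mul, smul_eq_mul]
      ring
    have hxy : (x * h.1).trace = ((resUp D).mapMatrix y * (T⁻¹ * h * T).1).trace := by
      rw [hy, Units.val_mul, Units.val_mul, mul_assoc, mul_assoc, Matrix.trace_mul_comm]
      simp only [mul_assoc]
    have e2 : resUp D (y * B' s' t').trace = c' * (x * h.1).trace := by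
      rw [← trace_map, map_mul, ← hA', Matrix.mul_smul, Matrix.trace_smul, hxy, smul_eq_mul]
    have hz : resUm D (coordFn D) ≠ 0 := fun h0 =>
      coordFn_ne_zero D (res_Um_injective D (h0.trans (map_zero _).symm))
    refine ⟨(x * h.1).trace, hx, ⟨(x₀ * B s t).trace, coordFn D ^ j • B s t, ?_, ?_⟩,
      (y * B' s' t').trace, B' s' t', ?_, ?_⟩
    · intro h0
      rw [h0, map_zero] at e1
      exact mul_ne_zero (mul_ne_zero (pow_ne_zero j hz) (mul_ne_zero hres hst)) hx e1.symm
    · have hsm : (resUm D).mapMatrix (coordFn D ^ j • B s t) =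
          resUm D (coordFn D) ^ j • (resUm D).mapMatrix (B s t) := by
        ext1 r u
        exact (map_mul (resUm D) _ _).trans (by rw [map_pow]; rfl)
      rw [e1, hsm, ← hA, smul_smul, smul_smul]
      congr 1
      ring
    · intro h0
      rw [h0, map_zero] at e2
      exact mul_ne_zero (mul_ne_zero hres' hst') hx e2.symm
    · rw [e2, ← hA', smul_smul, mul_comm]

end denominators

/-! ### From algebraic quotients to meromorphic functions, and the equivalence in (a). -/

section conclusion

variable {X : Type*} [TopologicalSpace X] [T2Space X] [ChartedSpace ℂ X]
  [IsManifold 𝓘(ℂ) ω X] {D : CoordDisk X} {n : ℕ} {G : StructureGroup} {k : ℕ} {T h : LGL D n}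

omit [T2Space X] in
/-- A quotient of a holomorphic matrix by a nonzero holomorphic function is meromorphic. -/
theorem matMeroAt_inv_smul {U : Opens X} (r : Hol U) (A : Matrix (Fin n) (Fin n) (Hol U)) {x : X}
    (hx : x ∈ U) : MatMeroAt (fun y => (zeroExt r y)⁻¹ • zeroExtMat A y) x := fun i j =>
  (holAt_zeroExt r hx).meroAt.inv.mul ((matHolAt_zeroExtMat A hx).matMeroAt i j)

omit [IsManifold 𝓘(ℂ) ω X] in
/-- From `r M = f A` with `M` invertible one gets `f⁻¹ M = r⁻¹ A` where `r` does not vanish. -/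
theorem inv_smul_eq_of_smul_eq [NeZero n] {r f : ℂ} {M A : Matrix (Fin n) (Fin n) ℂ}
    (hM : M.det ≠ 0) (hr : r ≠ 0) (e : r • M = f • A) : f ≠ 0 ∧ f⁻¹ • M = r⁻¹ • A := by
  have hf : f ≠ 0 := by
    rintro rfl
    rw [zero_smul, smul_eq_zero] at e
    rcases e with e | e
    · exact hr e
    · rw [e, Matrix.det_zero] at hM
      exact hM rfl
  refine ⟨hf, ?_⟩
  rw [inv_smul_eq_iff₀ hf, smul_comm, ← e, inv_smul_smul₀ hr]

theorem exists_isScalarTimesMeromorphic_of_smul_eq [NeZero n] [CompactSpace X] [ConnectedSpace X]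
    {f : Hol D.Upunct} (hf : f ≠ 0)
    {r : Hol D.Um} {A : Matrix (Fin n) (Fin n) (Hol D.Um)} (hr : r ≠ 0)
    (hA : resUm D r • h.1 = f • (resUm D).mapMatrix A)
    {s : Hol D.Up} {B : Matrix (Fin n) (Fin n) (Hol D.Up)} (hs : s ≠ 0)
    (hB : resUp D s • (T⁻¹ * h * T).1 = f • (resUp D).mapMatrix B) :
    ∃ (f : X → ℂ) (g m : X → Matrix (Fin n) (Fin n) ℂ), IsScalarTimesMeromorphic D T h f g m := by
  classical
  let g : X → Matrix (Fin n) (Fin n) ℂ := fun y => (zeroExt f y)⁻¹ • zeroExtMat h.1 y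
  -- The conjugation relation must hold at every point of the punctured disk, so it is the
  -- definition there. Off the zeros of `s` it agrees with the quotient `s⁻¹ B` used elsewhere.
  let m : X → Matrix (Fin n) (Fin n) ℂ := fun y =>
    if y ∈ D.Upunct then zeroExtMat (T⁻¹).1 y * g y * zeroExtMat T.1 y
    else (zeroExt s y)⁻¹ • zeroExtMat B y
  have hm : ∀ y ∈ D.Upunct, m y = zeroExtMat (T⁻¹).1 y * g y * zeroExtMat T.1 y :=
    fun y hy => if_pos hy
  have hA' : ∀ y ∈ D.Upunct, zeroExt r y • zeroExtMat h.1 y = zeroExt f y • zeroExtMat A y := by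
    intro y hy
    rw [zeroExt_of_mem r hy.1, zeroExt_of_mem f hy, zeroExtMat_of_mem _ hy,
      zeroExtMat_of_mem _ hy.1]
    exact congrArg (fun M => evalMat M ⟨y, hy⟩) hA
  have hB' : ∀ y ∈ D.Upunct, zeroExt s y • zeroExtMat (T⁻¹ * h * T).1 y =
      zeroExt f y • zeroExtMat B y := by
    intro y hy
    rw [zeroExt_of_mem s hy.2, zeroExt_of_mem f hy, zeroExtMat_of_mem _ hy,
      zeroExtMat_of_mem _ hy.2]
    exact congrArg (fun M => evalMat M ⟨y, hy⟩) hB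
  have hconj : ∀ y ∈ D.Upunct, zeroExtMat (T⁻¹ * h * T).1 y =
      zeroExtMat (T⁻¹).1 y * zeroExtMat h.1 y * zeroExtMat T.1 y := by
    intro y hy
    rw [zeroExtMat_of_mem _ hy, zeroExtMat_of_mem _ hy, zeroExtMat_of_mem _ hy,
      zeroExtMat_of_mem _ hy, Units.val_mul, Units.val_mul, evalMat_mul, evalMat_mul]
  have hcen : MatMeroAt g D.center := by
    refine (matMeroAt_inv_smul r A (center_mem_Um D)).congr ?_
    filter_upwards [eventually_mem_Upunct D,
      eventually_zeroExt_ne_zero (isConnected_Um D).isPreconnected hr (center_mem_Um D)] with y hy h0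
    exact (inv_smul_eq_of_smul_eq (det_zeroExtMat_ne_zero h hy) h0 (hA' y hy)).2.symm
  have hmero : ∀ x ∈ D.Up, MatMeroAt m x := by
    intro x hx
    refine (matMeroAt_inv_smul s B hx).congr ?_
    filter_upwards [eventually_zeroExt_ne_zero (isConnected_Up D).isPreconnected hs hx] with y h0
    by_cases hy : y ∈ D.Upunct
    · rw [hm y hy, Matrix.mul_smul, Matrix.smul_mul, ← hconj y hy]
      exact (inv_smul_eq_of_smul_eq (det_zeroExtMat_ne_zero _ hy) h0 (hB' y hy)).2.symm
    · exact (if_neg hy).symm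
  refine ⟨zeroExt f, g, m, fun x hx => (holAt_zeroExt f hx).meroAt, fun x hx => ?_, hcen,
    fun y => ?_, hmero, finite_of_forall_eventually_notMem fun x => ?_⟩
  · filter_upwards [eventually_zeroExt_ne_zero (isConnected_Upunct D).isPreconnected hf hx]
      with y hy hyU
    rw [smul_inv_smul₀ hy, zeroExtMat_of_mem _ hyU]
  · rw [hm y y.2, zeroExtMat_of_mem _ y.2, zeroExtMat_of_mem _ y.2]
  · by_cases hx : x = D.center
    · subst hx
      filter_upwards [hcen.eventually_matHolAt, eventually_mem_Upunct D] with y h1 hy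
      have h2 : poleOrder m y = 0 := by
        rw [← h1.poleOrder_eq_zero, ← poleOrder_mul_mul T⁻¹ T hy h1.matMeroAt]
        refine poleOrder_congr ?_
        filter_upwards [mem_nhdsWithin_of_mem_nhds (D.Upunct.isOpen.mem_nhds hy)] with w hw
        exact hm w hw
      simp [h2]
    · filter_upwards [(hmero x hx).eventually_matHolAt] with y h1
      simp [h1.poleOrder_eq_zero]

omit [IsManifold 𝓘(ℂ) ω X] in
theorem isScalarTimesMeromorphic_of_isEmpty [IsEmpty (Fin n)] (T h : LGL D n) :
    IsScalarTimesMeromorphic D T h 0 0 0 where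
  scalar_mero x _ := meroAt_const 0
  eq_mul x _ := Eventually.of_forall fun y _ => Subsingleton.elim _ _
  mero_center i := isEmptyElim i
  conj_eq y := Subsingleton.elim _ _
  mero x _ i := isEmptyElim i
  finite_poles := by simp [poleOrder]

theorem hasFiniteDimLeaf_iff [CompactSpace X] [ConnectedSpace X]
    (hsplit : IsCompl (loopPlus D G T) (loopMinus D n G k)) :
    HasFiniteDimLeaf D hsplit h ↔ ∃ (f : X → ℂ) (g m : X → Matrix (Fin n) (Fin n) ℂ),
      IsScalarTimesMeromorphic D T h f g m := by
  constructor
  · intro hfin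
    rcases Nat.eq_zero_or_pos n with rfl | hn
    · exact ⟨_, _, _, isScalarTimesMeromorphic_of_isEmpty T h⟩
    · have : NeZero n := ⟨hn.ne'⟩
      obtain ⟨f, hf, ⟨r, A, hr, hA⟩, s, B, hs, hB⟩ :=
        exists_scalar_of_hasFiniteDimLeaf hn hsplit hfin
      exact exists_isScalarTimesMeromorphic_of_smul_eq hf hr hA hs hB
  · rintro ⟨f, g, m, H⟩
    exact H.hasFiniteDimLeaf hsplit

end conclusion

end Sklyanin

end

theorem mainTheorem6 {X : Type*} [TopologicalSpace X] [T2Space X] [CompactSpace X]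
    [ConnectedSpace X] [ChartedSpace ℂ X] [IsManifold 𝓘(ℂ) ω X]
    (D : Sklyanin.CoordDisk X) (n : ℕ) (G : Sklyanin.StructureGroup) (k : ℕ)
    (T : Sklyanin.LGL D n)
    (hsplit : IsCompl (Sklyanin.loopPlus D G T) (Sklyanin.loopMinus D n G k)) :
    (∀ h : Sklyanin.LGL D n, Sklyanin.HasFiniteDimLeaf D hsplit h ↔
      ∃ (f : X → ℂ) (g m : X → Matrix (Fin n) (Fin n) ℂ),
        Sklyanin.IsScalarTimesMeromorphic D T h f g m) ∧
    (∀ (h : Sklyanin.LGL D n) (f : X → ℂ) (g m : X → Matrix (Fin n) (Fin n) ℂ),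
      Sklyanin.IsScalarTimesMeromorphic D T h f g m →
      ∀ h' ∈ Sklyanin.dressingOrbit D G k T h,
        ∃ g' m' : X → Matrix (Fin n) (Fin n) ℂ,
          Sklyanin.IsScalarTimesMeromorphic D T h' f g' m' ∧
          (Sklyanin.poleOrder g' D.center = Sklyanin.poleOrder g D.center ∧
            ∀ x ∈ D.Up, Sklyanin.poleOrder m' x = Sklyanin.poleOrder m x) ∧
          (Sklyanin.detOrd g' D.center = Sklyanin.detOrd g D.center ∧
            ∀ x ∈ D.Up, Sklyanin.detOrd m' x = Sklyanin.detOrd m x)) := by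
  refine ⟨fun h => Sklyanin.hasFiniteDimLeaf_iff hsplit, fun h f g m H h' hh => ?_⟩
  rcases Nat.eq_zero_or_pos n with rfl | hn
  -- For `n = 0` there is only one loop, and the cancellation of `f` is unavailable.
  · obtain rfl : h' = h := Units.ext (Subsingleton.elim _ _)
    exact ⟨g, m, H, ⟨rfl, fun _ _ => rfl⟩, rfl, fun _ _ => rfl⟩
  · have : NeZero n := ⟨hn.ne'⟩
    exact H.dressing hh
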